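/- **Notation.** Let $\beta$ be an indeterminate and put $x\oplus y=x+y+\beta xy$ and $\bar x=-\frac{x}{1+\beta x}$, so that $x\oplus\bar x=0$. For $X\in\{A,B,C,D\}$ let $W=W(X)$ be the Weyl group of infinite rank of type $X_\infty$, with its Coxeter generators $s_i$ $(i\in I)$, length function $\ell$ and Bruhat order $\le$, realized by signed permutations $v$ of $\{\pm1,\pm2,\dots\}$ (so $v(-k)=-v(k)$): for $k\ge 1$, $s_k$ exchanges $k$ and $k+1$; in types $B$ and $C$ there is in addition $s_0$, which exchanges $1$ and $-1$; in type $D$ there is in addition $s_{\hat 1}$, which exchanges $1$ and $-2$ (and $2$ and $-1$). Let $W(X_n)$ be the subgroup generated by the $s_k$ with $1\le k\le n-1$ together with $s_0$ (types $B,C$; $n\ge1$) or $s_{\hat 1}$ (type $D$; $n\ge 2$). Let $R^{b,\bar b}=\mathbb Z[\beta][b_1,\bar b_1,b_2,\bar b_2,\dots]$, and write $b_{-k}=\bar b_k$. The group $W$ acts on $R^{b,\bar b}$ by $\mathbb Z[\beta]$-algebra automorphisms with $v(b_k)=b_{v(k)}$. Put $\alpha_i(b)=b_i\oplus\bar b_{i+1}$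 for $i\ge1$, $\alpha_0(b)=\bar b_1$ in type $B$, $\alpha_0(b)=\bar b_1\oplus\bar b_1$ in type $C$, and $\alpha_{\hat 1}(b)=\bar b_1\oplus\bar b_2$ in type $D$. Let $\mathrm{Id}_\beta(W)$ be the $\mathbb Z[\beta]$-algebra generated by $u_i$ $(i\in I)$ with the relations $u_i^2=\beta u_i$ and the braid relations $u_iu_ju_i\cdots=u_ju_iu_j\cdots$ ($m_{ij}$ factors on each side, $m_{ij}$ the order of $s_is_j$). It has the basis $(u_w)_{w\in W}$, where $u_w=u_{i_1}\cdots u_{i_\ell}$ for a reduced decomposition $w=s_{i_1}\cdots s_{i_\ell}$. Extend the coefficients as needed and put $h_i(y)=1+yu_i$. For $1\le i\le n-1$ let $A_i^{(n)}(y)=h_{n-1}(y)h_{n-2}(y)\cdots h_i(y)$, and let $G_{A_{n-1}}(y)=A_1^{(n)}(y_1)A_2^{(n)}(y_2)\cdots A_{n-1}^{(n)}(y_{n-1})$. Let $$F_n^B(y)=h_{n-1}(y)\cdots h_1(y)\,h_0(y)\,h_1(y)\cdots h_{n-1}(y),\qquad F_n^C(y)=h_{n-1}(y)\cdots h_1(y)\,h_0(y)^2\,h_1(y)\cdots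 h_{n-1}(y),$$ $$F_n^D(y)=h_{n-1}(y)\cdots h_2(y)\,h_1(y)h_{\hat1}(y)\,h_2(y)\cdots h_{n-1}(y)\quad(n\ge2),\qquad F_n^A(y)=1.$$ Define polynomials $\mathcal G^X_{n,w}(a,b;x)$ in the variables $a_k$, $b_k$ and $x_1,\dots,x_n$ by $$G_{A_{n-1}}(\bar b)^{-1}\,F_n^X(x_1)\cdots F_n^X(x_n)\,G_{A_{n-1}}(a)=\sum_{w\in W(X_n)}\mathcal G^X_{n,w}(a,b;x)\,u_w .$$ They are stable: for $w\in W(X_n)$, $\mathcal G^X_{n+1,w}$ becomes $\mathcal G^X_{n,w}$ when $x_{n+1}=0$. Let $\mathcal G^X_w=\mathcal G^X_w(a,b;x)$ be their limit, an element of the inverse limit over $n$ of the rings $R^{b,\bar b}[a_1,a_2,\dots][x_1,\dots,x_n]$ along the maps $x_{n+1}\mapsto0$. (In type $A$ it does not involve $x$ and is the double Grothendieck polynomial $\mathcal G^A_w(a,b)$.) The algebraic localization map $\Phi^X$ sends an element $f(a,b;x)$ of that inverse limit to the function $W\to R^{b,\bar b}$ whose value $\Phi^X(f)(v)$ at $v\in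 W$ is obtained by the substitution, for all $k\ge1$, of $a_k=\bar b_{v(k)}$ (that is, $a_k=b_{-v(k)}$), of $x_k=b_{v(k)}$ if $v(k)<0$, and of $x_k=0$ if $v(k)>0$. Let $R^{b,\bar b}\#\mathbb Z[W]$ be the smash product, with $(f\otimes v)(g\otimes w)=f\,v(g)\otimes vw$, and let $\epsilon:R^{b,\bar b}\#\mathbb Z[W]\to R^{b,\bar b}$ be the $R^{b,\bar b}$-linear map with $\epsilon(f\otimes w)=f$. **Statement.** Let $X\in\{A,B,C,D\}$ and $w,v\in W(X)$. (1) For every reduced decomposition $v=s_{i_1}s_{i_2}\cdots s_{i_r}$, with $\mathbf i=(i_1,\dots,i_r)$, $$\Phi^X(\mathcal G^X_w)(v)=\epsilon\left(\sum_{c\in C(\mathbf i,w)}\beta^{|c|-\ell(w)}\prod_{k=1}^{r}\begin{cases}\alpha_{i_k}(b)\otimes s_{i_k}&\text{if }c_k=1,\\ 1\otimes s_{i_k}&\text{if }c_k=0\end{cases}\right),$$ where the product is taken in the order $k=1,\dots,r$, $|c|=c_1+\cdots+c_r$, and $C(\mathbf i,w)$ is the set of the $c=(c_1,\dots,c_r)\in\{0,1\}^r$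 with $|c|\ge\ell(w)$ and $\prod_{k:\,c_k=1}u_{i_k}=\beta^{|c|-\ell(w)}u_w$ in $\mathrm{Id}_\beta(W)$ (product in the order of increasing $k$); equivalently, the subword of $\mathbf i$ selected by $c$ has Demazure product $w$. (2) $\Phi^X(\mathcal G^X_w)(v)=0$ unless $w\le v$. -/

import Mathlib

namespace KGroth

section Coxeter

open CoxeterSystem

variable {B W : Type*} [Group W] {M : CoxeterMatrix B} (cs : CoxeterSystem M W)

open Classical in
noncomputable def signedConj (i : B) : Function.End (W × ZMod 2) :=
  fun p => (cs.simple i * p.1 * cs.simple i, p.2 + if p.1 = cs.simple i then 1 else 0)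

open Classical in
theorem signedConj_word (ω : List B) (t : W) (e : ZMod 2) :
    (ω.map (signedConj cs)).prod (t, e) =
      (cs.wordProd ω * t * (cs.wordProd ω)⁻¹, e + ((cs.rightInvSeq ω).count t : ℕ)) := by
  induction ω with
  | nil => simp [Function.End.one_def]
  | cons i ω ih =>
    rw [List.map_cons, List.prod_cons]
    change signedConj cs i ((ω.map (signedConj cs)).prod (t, e)) = _
    rw [ih]
    have h : cs.wordProd ω * t * (cs.wordProd ω)⁻¹ = cs.simple i ↔
        (cs.wordProd ω)⁻¹ * cs.simple i * cs.wordProd ω = t := by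
      constructor
      · intro h; rw [← h]; group
      · intro h; rw [← h]; group
    simp only [signedConj, cs.wordProd_cons, rightInvSeq, List.count_cons, mul_inv_rev, inv_simple,
      h, beq_iff_eq, Prod.mk.injEq]
    refine ⟨by group, ?_⟩
    split_ifs <;> push_cast <;> ring

theorem alternating_map_prod {G : Type*} [Monoid G] (f : B → G) (i j : B) (m : ℕ) :
    ((alternatingWord i j (2 * m)).map f).prod = (f i * f j) ^ m := by
  induction m with
  | zero => simp [alternatingWord]
  | succ m ih =>
    rw [show 2 * (m + 1) = 2 * m + 1 + 1 by ring, alternatingWord_succ', alternatingWord_succ']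
    simp [ih, pow_succ', mul_assoc, parity_simps]

theorem alternating_reverse (i j : B) (m : ℕ) :
    (alternatingWord i j (2 * m)).reverse = alternatingWord j i (2 * m) := by
  apply List.ext_getElem (by simp)
  intro k h1 h2
  simp only [List.length_reverse, length_alternatingWord] at h1
  rw [List.getElem_reverse, getElem_alternatingWord _ _ _ _ h1,
    getElem_alternatingWord _ _ _ _ (by simp; omega)]
  simp only [length_alternatingWord]
  split_ifs with h3 h4 h4
  · grind
  · rfl
  · rfl
  · grind

theorem leftInvSeq_alternating (i j : B) :
    cs.leftInvSeq (alternatingWord i j (2 * M i j)) =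
      (List.range (M i j)).map (fun k => cs.wordProd (alternatingWord j i (2 * k + 1))) ++
      (List.range (M i j)).map (fun k => cs.wordProd (alternatingWord j i (2 * k + 1))) := by
  apply List.ext_getElem (by simp; omega)
  intro k h1 h2
  have h1' : k < 2 * M i j := by simpa using h1
  rw [cs.getElem_leftInvSeq_alternatingWord i j _ k h1', List.getElem_append]
  split_ifs with h
  · simp
  · simp only [List.length_map, List.length_range, not_lt] at h
    simp only [List.getElem_map, List.length_map, List.length_range, List.getElem_range,
      cs.prod_alternatingWord_eq_mul_pow]
    have e1 : ¬ Even (2 * k + 1) := by simp [parity_simps]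
    have e2 : ¬ Even (2 * (k - M i j) + 1) := by simp [parity_simps]
    rw [if_neg e1, if_neg e2, show (2 * k + 1) / 2 = (k - M i j) + M i j by omega,
      show (2 * (k - M i j) + 1) / 2 = k - M i j by omega, pow_add, cs.simple_mul_simple_pow']
    simp

theorem signedConj_liftable : M.IsLiftable (signedConj cs) := by
  classical
  intro i j
  rw [← alternating_map_prod]
  funext ⟨t, e⟩
  rw [signedConj_word, ← alternating_reverse, cs.rightInvSeq_reverse, List.count_reverse,
    alternating_reverse, M.symmetric i j, leftInvSeq_alternating, List.count_append]
  have : cs.wordProd (alternatingWord i j (2 * M j i)) = 1 := by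
    rw [cs.prod_alternatingWord_eq_mul_pow]; simp
  rw [this]
  simp only [one_mul, inv_one, mul_one, Function.End.one_def, id]
  rw [Nat.cast_add, CharTwo.add_self_eq_zero, add_zero]

open Classical in
theorem count_rightInvSeq_congr {ω ω' : List B} (h : cs.wordProd ω = cs.wordProd ω') (t : W) :
    ((cs.rightInvSeq ω).count t : ZMod 2) = ((cs.rightInvSeq ω').count t : ℕ) := by
  have key : ∀ ω : List B, (ω.map (signedConj cs)).prod =
      cs.lift ⟨signedConj cs, signedConj_liftable cs⟩ (cs.wordProd ω) := by
    intro ω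
    rw [wordProd, map_list_prod, List.map_map]
    congr 1
    apply List.map_congr_left
    intro i _
    simp [cs.lift_apply_simple]
  have := congrFun (((key ω).trans (by rw [h])).trans (key ω').symm) (t, 0)
  rw [signedConj_word, signedConj_word] at this
  simpa using congrArg Prod.snd this

theorem mem_rightInvSeq_of_descent {ω : List B} {i : B}
    (h : cs.length (cs.wordProd ω * cs.simple i) < cs.length (cs.wordProd ω)) :
    cs.simple i ∈ cs.rightInvSeq ω := by
  classical
  obtain ⟨η, hη, hw⟩ := cs.exists_isReduced (cs.wordProd ω * cs.simple i)
  have e : cs.wordProd (η.concat i) = cs.wordProd ω := by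
    rw [cs.wordProd_concat, ← hw, cs.simple_mul_simple_cancel_right]
  have hr : cs.IsReduced (η.concat i) := by
    rw [CoxeterSystem.IsReduced, e]
    have := cs.length_mul_simple (cs.wordProd ω) i
    have h2 : cs.length (cs.wordProd η) = η.length := hη
    rw [← hw] at h2
    simp; omega
  have hc : (cs.rightInvSeq (η.concat i)).count (cs.simple i) = 1 :=
    List.count_eq_one_of_mem hr.nodup_rightInvSeq (by rw [rightInvSeq_concat]; simp)
  have := count_rightInvSeq_congr cs e (cs.simple i)
  rw [hc] at this
  by_contra hn
  rw [List.count_eq_zero_of_not_mem hn] at this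
  simp at this

theorem mem_leftInvSeq_of_descent {ω : List B} {i : B}
    (h : cs.length (cs.simple i * cs.wordProd ω) < cs.length (cs.wordProd ω)) :
    cs.simple i ∈ cs.leftInvSeq ω := by
  have : cs.simple i ∈ cs.rightInvSeq ω.reverse := by
    apply mem_rightInvSeq_of_descent
    rw [cs.wordProd_reverse, cs.length_inv, ← cs.length_inv]
    simpa using h
  rw [cs.rightInvSeq_reverse] at this
  simpa using this

/-- Exchange property. -/
theorem exchange {ω : List B} {i : B}
    (h : cs.length (cs.simple i * cs.wordProd ω) < cs.length (cs.wordProd ω)) :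
    ∃ k, k < ω.length ∧ cs.simple i * cs.wordProd ω = cs.wordProd (ω.eraseIdx k) := by
  obtain ⟨k, hk, e⟩ := List.mem_iff_getElem.mp (mem_leftInvSeq_of_descent cs h)
  refine ⟨k, by simpa using hk, ?_⟩
  rw [← cs.getD_leftInvSeq_mul_wordProd, List.getD_eq_getElem _ _ hk, e]

theorem isReduced_tail {i : B} {ω : List B} (h : cs.IsReduced (i :: ω)) : cs.IsReduced ω := by
  simpa using h.drop 1

theorem isReduced_cons_iff {i : B} {ω : List B} (h : cs.IsReduced ω) :
    cs.IsReduced (i :: ω) ↔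
      cs.length (cs.wordProd ω) < cs.length (cs.simple i * cs.wordProd ω) := by
  have h1 : cs.length (cs.wordProd ω) = ω.length := h
  have := cs.length_simple_mul (cs.wordProd ω) i
  rw [CoxeterSystem.IsReduced, cs.wordProd_cons, List.length_cons]
  omega

theorem isReduced_of_nodup {ω : List B} (h : (cs.leftInvSeq ω).Nodup) : cs.IsReduced ω := by
  induction ω with
  | nil => simp [CoxeterSystem.IsReduced]
  | cons i ω ih =>
    rw [leftInvSeq, List.nodup_cons] at h
    have hω := ih (List.Nodup.of_map _ h.2)
    rw [isReduced_cons_iff cs hω]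
    by_contra hlt
    have hlt' : cs.length (cs.simple i * cs.wordProd ω) < cs.length (cs.wordProd ω) :=
      lt_of_le_of_ne (not_lt.mp hlt) (cs.length_simple_mul_ne _ _)
    apply h.1
    rw [List.mem_map]
    exact ⟨cs.simple i, mem_leftInvSeq_of_descent cs hlt', by simp⟩

/-- If `s_i s_j` has order `M i j`, alternating words of length at most `M i j` are reduced. -/
theorem isReduced_alternating (hord : ∀ i j d, 0 < d → d < M i j →
    (cs.simple i * cs.simple j) ^ d ≠ 1) (i j : B) (p : ℕ) (hp : p ≤ M i j) :
    cs.IsReduced (alternatingWord i j p) := by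
  have main : ∀ i j : B, (cs.leftInvSeq (alternatingWord i j (2 * M i j))).take (M i j) |>.Nodup := by
    intro i j
    rw [leftInvSeq_alternating, List.take_left' (by simp)]
    rw [List.nodup_map_iff_inj_on List.nodup_range]
    have key : ∀ x y, x < y → y < M i j → cs.wordProd (alternatingWord j i (2 * x + 1)) ≠
        cs.wordProd (alternatingWord j i (2 * y + 1)) := by
      intro x y hxy hy he
      simp only [cs.prod_alternatingWord_eq_mul_pow] at he
      have e1 : ¬ Even (2 * x + 1) := by simp [parity_simps]
      have e2 : ¬ Even (2 * y + 1) := by simp [parity_simps]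
      rw [if_neg e1, if_neg e2, show (2 * x + 1) / 2 = x by omega,
        show (2 * y + 1) / 2 = (y - x) + x by omega, pow_add, ← mul_assoc, eq_comm] at he
      have := mul_right_cancel he
      rw [mul_eq_left] at this
      exact hord j i (y - x) (by omega) (by rw [M.symmetric]; omega) this
    intro x hx y hy he
    rw [List.mem_range] at hx hy
    rcases lt_trichotomy x y with h | h | h
    · exact absurd he (key x y h hy)
    · exact h
    · exact absurd he.symm (key y x h hx)
  have full : ∀ i j : B, cs.IsReduced (alternatingWord i j (M i j)) := by
    intro i j
    by_cases h0 : M i j = 0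
    · rw [h0]; simp [CoxeterSystem.IsReduced, alternatingWord]
    have h1 := main i j
    rw [← cs.leftInvSeq_take, listTake_alternatingWord i j _ _ (by omega)] at h1
    have h2 := main j i
    rw [← cs.leftInvSeq_take, listTake_alternatingWord j i _ _ (by rw [M.symmetric]; omega)] at h2
    rw [M.symmetric j i] at h2
    split_ifs at h1 h2 with h
    · exact isReduced_of_nodup cs h1
    · exact isReduced_of_nodup cs h2
  have := (full i j).drop (M i j - p)
  convert this using 1
  obtain ⟨q, hq⟩ := Nat.exists_eq_add_of_le hp
  rw [hq]
  clear hq this hp full main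
  induction q with
  | zero => simp
  | succ q ih =>
    rw [← add_assoc, alternatingWord_succ', show p + q + 1 - p = (p + q - p) + 1 by omega,
      List.drop_succ_cons]
    exact ih

/-- Words in a set `S` of generators can be reduced inside `S`. -/
theorem exists_reduced_in (S : Set B) {w : W}
    (hw : w ∈ Subgroup.closure (cs.simple '' S)) :
    ∃ ω : List B, cs.IsReduced ω ∧ cs.wordProd ω = w ∧ ∀ i ∈ ω, i ∈ S := by
  have step : ∀ x ∈ cs.simple '' S, ∀ y : W,
      (∃ ω : List B, cs.IsReduced ω ∧ cs.wordProd ω = y ∧ ∀ i ∈ ω, i ∈ S) →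
      ∃ ω : List B, cs.IsReduced ω ∧ cs.wordProd ω = x * y ∧ ∀ i ∈ ω, i ∈ S := by
    rintro _ ⟨i, hi, rfl⟩ y ⟨ω, hω, rfl, hS⟩
    by_cases h : cs.length (cs.wordProd ω) < cs.length (cs.simple i * cs.wordProd ω)
    · refine ⟨i :: ω, (isReduced_cons_iff cs hω).2 h, cs.wordProd_cons _ _, ?_⟩
      simpa using ⟨hi, hS⟩
    · have hlt : cs.length (cs.simple i * cs.wordProd ω) < cs.length (cs.wordProd ω) :=
        lt_of_le_of_ne (not_lt.mp h) (cs.length_simple_mul_ne _ _)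
      obtain ⟨k, hk, e⟩ := exchange cs hlt
      refine ⟨ω.eraseIdx k, ?_, e.symm, fun j hj => hS j (List.mem_of_mem_eraseIdx hj)⟩
      have h1 : cs.length (cs.wordProd ω) = ω.length := hω
      have := cs.length_simple_mul (cs.wordProd ω) i
      rw [CoxeterSystem.IsReduced, ← e, List.length_eraseIdx_of_lt hk]
      omega
  induction hw using Subgroup.closure_induction_left with
  | one => exact ⟨[], by simp [CoxeterSystem.IsReduced], by simp, by simp⟩
  | mul_left x hx y hy ih => exact step x hx y ih
  | inv_mul_cancel x hx y hy ih =>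
    obtain ⟨i, hi, rfl⟩ := hx
    rw [cs.inv_simple]
    exact step _ ⟨i, hi, rfl⟩ y ih

theorem exists_alternating_prefix (hord : ∀ i j d, 0 < d → d < M i j →
    (cs.simple i * cs.simple j) ^ d ≠ 1) {w : W} {i j : B}
    (hi : cs.length (cs.simple i * w) < cs.length w)
    (hj : cs.length (cs.simple j * w) < cs.length w) (p : ℕ) (hp : p ≤ M i j) :
    ∃ η, cs.IsReduced (alternatingWord i j p ++ η) ∧
      cs.wordProd (alternatingWord i j p ++ η) = w := by
  have main : ∀ p, p ≤ M i j → ∀ i' j', (i' = i ∧ j' = j ∨ i' = j ∧ j' = i) →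
      ∃ η, cs.IsReduced (alternatingWord i' j' p ++ η) ∧
      cs.wordProd (alternatingWord i' j' p ++ η) = w := by
    intro p
    induction p with
    | zero =>
      intro _ i' j' _
      obtain ⟨ω, h1, h2⟩ := cs.exists_isReduced w
      exact ⟨ω, by simpa [alternatingWord] using h1, by simpa [alternatingWord] using h2.symm⟩
    | succ p ih =>
      intro hp i' j' hij
      obtain ⟨η, h1, h2⟩ := ih (by omega) i' j' hij
      have hM : M i' j' = M i j := by
        rcases hij with ⟨rfl, rfl⟩ | ⟨rfl, rfl⟩
        · rfl
        · exact M.symmetric _ _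
      have hred := isReduced_alternating cs hord i' j' (p + 1) (by omega)
      rw [alternatingWord_succ'] at hred ⊢
      set k := if Even p then j' else i' with hk
      have hkd : cs.length (cs.simple k * w) < cs.length w := by
        rw [hk]; rcases hij with ⟨rfl, rfl⟩ | ⟨rfl, rfl⟩ <;> split_ifs <;> assumption
      rw [← h2] at hkd
      obtain ⟨n, hn, e⟩ := exchange cs hkd
      by_cases hnp : n < p
      · exfalso
        rw [List.eraseIdx_append_of_lt_length (by simpa using hnp), cs.wordProd_append,
          cs.wordProd_append, ← mul_assoc] at e
        have e' := mul_right_cancel e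
        have l1 : cs.length (cs.wordProd (k :: alternatingWord i' j' p)) = _ := hred
        rw [cs.wordProd_cons, e'] at l1
        have l2 := cs.length_wordProd_le ((alternatingWord i' j' p).eraseIdx n)
        rw [List.length_eraseIdx_of_lt (by simpa using hnp)] at l2
        simp at l1 l2
        omega
      · rw [List.eraseIdx_append_of_length_le (by simpa using hnp), length_alternatingWord] at e
        have e2 : cs.wordProd (k :: alternatingWord i' j' p ++ η.eraseIdx (n - p)) = w := by
          rw [List.cons_append, cs.wordProd_cons, ← e, cs.simple_mul_simple_cancel_left, h2]
        refine ⟨η.eraseIdx (n - p), ?_, e2⟩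
        rw [CoxeterSystem.IsReduced, e2, ← h2]
        have h3 : cs.length _ = _ := h1
        rw [h3]
        simp at hn
        simp [List.length_eraseIdx_of_lt (show n - p < η.length by omega)]
        omega
  exact main p hp i j (Or.inl ⟨rfl, rfl⟩)

/-- Matsumoto's theorem: a map on generators that satisfies the braid relations takes the same
value on all reduced words of an element. -/
theorem matsumoto (hord : ∀ i j d, 0 < d → d < M i j → (cs.simple i * cs.simple j) ^ d ≠ 1)
    (hM : ∀ i j, M i j ≠ 0) {G : Type*} [Monoid G] (f : B → G)
    (hf : ∀ i j, ((braidWord M i j).map f).prod = ((braidWord M j i).map f).prod)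
    (n : ℕ) : ∀ ω ω' : List B, ω.length = n → cs.IsReduced ω → cs.IsReduced ω' →
      cs.wordProd ω = cs.wordProd ω' → (ω.map f).prod = (ω'.map f).prod := by
  induction n using Nat.strong_induction_on with
  | _ n ih =>
    have same : ∀ (i : B) (ω ω' : List B), (i :: ω).length = n → cs.IsReduced (i :: ω) →
        cs.IsReduced (i :: ω') → cs.wordProd (i :: ω) = cs.wordProd (i :: ω') →
        ((i :: ω).map f).prod = ((i :: ω').map f).prod := by
      intro i ω ω' h0 h1 h2 he
      rw [cs.wordProd_cons, cs.wordProd_cons] at he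
      rw [List.map_cons, List.map_cons, List.prod_cons, List.prod_cons,
        ih ω.length (by simp at h0; omega) ω ω' rfl (isReduced_tail cs h1) (isReduced_tail cs h2)
          (mul_left_cancel he)]
    intro ω ω' h0 h1 h2 he
    have hlen : ω'.length = ω.length := by rw [← h2.eq, ← he, h1.eq]
    match ω, ω', h0, h1, h2, he, hlen with
    | [], [], _, _, _, _, _ => rfl
    | [], j :: ω', _, _, _, _, hlen => simp at hlen
    | i :: ω, [], _, _, _, _, hlen => simp at hlen
    | i :: ω, j :: ω', h0, h1, h2, he, hlen =>
      have hi : cs.length (cs.simple i * cs.wordProd (i :: ω)) <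
          cs.length (cs.wordProd (i :: ω)) := by
        rw [h1.eq, cs.wordProd_cons, cs.simple_mul_simple_cancel_left]
        exact lt_of_le_of_lt (cs.length_wordProd_le ω) (by simp)
      have hj : cs.length (cs.simple j * cs.wordProd (i :: ω)) <
          cs.length (cs.wordProd (i :: ω)) := by
        rw [he, h2.eq, cs.wordProd_cons, cs.simple_mul_simple_cancel_left]
        exact lt_of_le_of_lt (cs.length_wordProd_le ω') (by simp)
      obtain ⟨m, hm⟩ := Nat.exists_eq_succ_of_ne_zero (hM i j)
      obtain ⟨η, a1, a2⟩ := exists_alternating_prefix cs hord hi hj (M i j) le_rfl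
      obtain ⟨η', b1, b2⟩ := exists_alternating_prefix cs hord hj hi (M j i) le_rfl
      have hM' : M j i = m + 1 := by rw [M.symmetric, hm]
      have la : (alternatingWord i j (M i j) ++ η).length = n := by
        rw [← a1.eq, a2, h1.eq, h0]
      have lb : (alternatingWord j i (M j i) ++ η').length = n := by
        rw [← b1.eq, b2, h1.eq, h0]
      have eη : (η.map f).prod = (η'.map f).prod := by
        refine ih η.length (by simp at la; omega) η η' rfl ?_ ?_ ?_
        · simpa using a1.drop (alternatingWord i j (M i j)).length
        · simpa using b1.drop (alternatingWord j i (M j i)).length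
        · have := a2.trans b2.symm
          rw [cs.wordProd_append, cs.wordProd_append, cs.wordProd_braidWord_eq] at this
          exact mul_left_cancel this
      have eab : ((alternatingWord i j (M i j) ++ η).map f).prod =
          ((alternatingWord j i (M j i) ++ η').map f).prod := by
        rw [List.map_append, List.map_append, List.prod_append, List.prod_append, eη]
        congr 1
        exact hf i j
      rw [hm, alternatingWord_succ'] at a1 a2 la eab
      rw [hM', alternatingWord_succ'] at b1 b2 lb eab
      by_cases hev : Even m
      · rw [if_pos hev] at a1 a2 b1 b2 la lb
        rw [if_pos hev, if_pos hev] at eab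
        have t1 := same i _ _ h0 h1 b1 b2.symm
        have t2 := same j _ _ la a1 h2 (a2.trans he)
        exact t1.trans (eab.symm.trans t2)
      · rw [if_neg hev] at a1 a2 b1 b2 la lb
        rw [if_neg hev, if_neg hev] at eab
        have t1 := same i _ _ h0 h1 a1 a2.symm
        have t2 := same j _ _ lb b1 h2 (b2.trans he)
        exact t1.trans (eab.trans t2)


/-! ### The idCoxeter algebra -/

/-- The defining relations of the idCoxeter algebra (with parameter `β` in the ring of scalars `K`):
`u_i ^ 2 = β u_i` and `u_i u_j u_i ⋯ = u_j u_i u_j ⋯` (`M i j` factors on both sides). -/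
inductive IdRel (M : CoxeterMatrix B) (K : Type*) [CommRing K] (β : K) :
    FreeAlgebra K B → FreeAlgebra K B → Prop
  | sq (i : B) : IdRel M K β (FreeAlgebra.ι K i * FreeAlgebra.ι K i) (β • FreeAlgebra.ι K i)
  | braid (i j : B) : IdRel M K β (((braidWord M i j).map (FreeAlgebra.ι K)).prod)
      (((braidWord M j i).map (FreeAlgebra.ι K)).prod)

/-- The idCoxeter algebra of the Coxeter matrix `M` over `K`. -/
abbrev IdCoxeter (M : CoxeterMatrix B) (K : Type*) [CommRing K] (β : K) : Type _ :=
  RingQuot (IdRel M K β)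

variable {K : Type*} [CommRing K] (β : K)

/-- The generators `u_i`. -/
def uGen (M : CoxeterMatrix B) (β : K) (i : B) : IdCoxeter M K β :=
  RingQuot.mkAlgHom K (IdRel M K β) (FreeAlgebra.ι K i)

/-- `u_w = u_{i_1} ⋯ u_{i_l}` for a reduced word of `w`; see `uElt_eq` for the independence. -/
noncomputable def uElt (w : W) : IdCoxeter M K β :=
  ((cs.exists_isReduced w).choose.map (uGen M β)).prod

theorem uGen_sq (i : B) : uGen M β i * uGen M β i = β • uGen M β i := by
  have := RingQuot.mkAlgHom_rel K (IdRel.sq (M := M) (β := β) i)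
  simpa [uGen] using this

theorem uGen_braid (i j : B) : ((braidWord M i j).map (uGen M β)).prod =
    ((braidWord M j i).map (uGen M β)).prod := by
  have := RingQuot.mkAlgHom_rel K (IdRel.braid (M := M) (β := β) i j)
  rw [map_list_prod, map_list_prod, List.map_map, List.map_map] at this
  exact this

/-- The universal property of the idCoxeter algebra. -/
noncomputable def idLift {A : Type*} [Ring A] [Algebra K A] (f : B → A)
    (h1 : ∀ i, f i * f i = β • f i)
    (h2 : ∀ i j, ((braidWord M i j).map f).prod = ((braidWord M j i).map f).prod) :
    IdCoxeter M K β →ₐ[K] A :=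
  RingQuot.liftAlgHom K ⟨FreeAlgebra.lift K f, by
    intro a b hab
    cases hab with
    | sq i => simpa using h1 i
    | braid i j =>
      rw [map_list_prod, map_list_prod, List.map_map, List.map_map]
      simpa [Function.comp_def] using h2 i j⟩

@[simp] theorem idLift_uGen {A : Type*} [Ring A] [Algebra K A] (f : B → A)
    (h1 : ∀ i, f i * f i = β • f i)
    (h2 : ∀ i j, ((braidWord M i j).map f).prod = ((braidWord M j i).map f).prod) (i : B) :
    idLift β f h1 h2 (uGen M β i) = f i := by
  simp [idLift, uGen]

open Classical in
/-- Left multiplication by `u_i` in the basis `u_w`. -/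
noncomputable def leftOp (i : B) : Module.End K (W →₀ K) :=
  Finsupp.linearCombination K fun w =>
    if cs.length w < cs.length (cs.simple i * w) then Finsupp.single (cs.simple i * w) 1
    else Finsupp.single w β

open Classical in
/-- Right multiplication by `u_i` in the basis `u_w`. -/
noncomputable def rightOp (i : B) : Module.End K (W →₀ K) :=
  Finsupp.linearCombination K fun w =>
    if cs.length w < cs.length (w * cs.simple i) then Finsupp.single (w * cs.simple i) 1
    else Finsupp.single w β

theorem leftOp_up {i : B} {w : W} (h : cs.length w < cs.length (cs.simple i * w)) (c : K) :
    leftOp cs β i (Finsupp.single w c) = Finsupp.single (cs.simple i * w) c := by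
  simp [leftOp, h]

theorem leftOp_down {i : B} {w : W} (h : ¬ cs.length w < cs.length (cs.simple i * w)) (c : K) :
    leftOp cs β i (Finsupp.single w c) = Finsupp.single w (c * β) := by
  simp [leftOp, h]

theorem rightOp_up {i : B} {w : W} (h : cs.length w < cs.length (w * cs.simple i)) (c : K) :
    rightOp cs β i (Finsupp.single w c) = Finsupp.single (w * cs.simple i) c := by
  simp [rightOp, h]

theorem rightOp_down {i : B} {w : W} (h : ¬ cs.length w < cs.length (w * cs.simple i)) (c : K) :
    rightOp cs β i (Finsupp.single w c) = Finsupp.single w (c * β) := by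
  simp [rightOp, h]

theorem simple_mul_eq_mul_simple {i j : B} {w : W}
    (h1 : cs.length w < cs.length (cs.simple i * w))
    (h2 : cs.length w < cs.length (w * cs.simple j))
    (h3 : cs.length (cs.simple i * (w * cs.simple j)) < cs.length (w * cs.simple j)) :
    cs.simple i * w = w * cs.simple j := by
  obtain ⟨ω, hω, rfl⟩ := cs.exists_isReduced w
  rw [← cs.wordProd_concat, List.concat_eq_append] at h3
  obtain ⟨k, hk, e⟩ := exchange cs h3
  have hl := hω.eq
  by_cases hkl : k < ω.length
  · exfalso
    rw [List.eraseIdx_append_of_lt_length hkl, cs.wordProd_append, cs.wordProd_append,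
      ← mul_assoc] at e
    have e' := mul_right_cancel e
    have := cs.length_wordProd_le (ω.eraseIdx k)
    rw [← e', List.length_eraseIdx_of_lt hkl] at this
    omega
  · rw [List.eraseIdx_append_of_length_le (by omega)] at e
    have : k - ω.length = 0 := by simp at hk; omega
    rw [this] at e
    simp only [List.eraseIdx_cons_zero, List.append_nil, cs.wordProd_append,
      cs.wordProd_singleton] at e
    calc cs.simple i * cs.wordProd ω
        = cs.simple i * (cs.wordProd ω * cs.simple j) * cs.simple j := by
          simp [mul_assoc]
      _ = cs.wordProd ω * cs.simple j := by rw [e]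

theorem leftOp_rightOp (i j : B) :
    leftOp cs β i * rightOp cs β j = rightOp cs β j * leftOp cs β i := by
  apply Finsupp.lhom_ext
  intro w c
  simp only [Module.End.mul_apply]
  have a1 := cs.length_simple_mul w i
  have a2 := cs.length_mul_simple w j
  have a3 := cs.length_simple_mul (w * cs.simple j) i
  have a4 := cs.length_mul_simple (cs.simple i * w) j
  rw [mul_assoc] at a4
  by_cases h1 : cs.length w < cs.length (cs.simple i * w)
  · by_cases h2 : cs.length w < cs.length (w * cs.simple j)
    · rw [leftOp_up cs β h1, rightOp_up cs β h2]
      by_cases h3 : cs.length (cs.simple i * (w * cs.simple j)) < cs.length (w * cs.simple j)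
      · have e := simple_mul_eq_mul_simple cs h1 h2 h3
        rw [leftOp_down cs β (by omega), rightOp_down cs β (by rw [mul_assoc]; omega), e]
      · rw [leftOp_up cs β (by omega), rightOp_up cs β (by rw [mul_assoc]; omega), mul_assoc]
    · rw [leftOp_up cs β h1, rightOp_down cs β h2, leftOp_up cs β h1,
        rightOp_down cs β (by rw [mul_assoc]; omega)]
  · by_cases h2 : cs.length w < cs.length (w * cs.simple j)
    · rw [leftOp_down cs β h1, rightOp_up cs β h2, rightOp_up cs β h2,
        leftOp_down cs β (by omega)]
    · rw [leftOp_down cs β h1, rightOp_down cs β h2, leftOp_down cs β h1, rightOp_down cs β h2]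

theorem leftOp_word {ω : List B} (h : cs.IsReduced ω) :
    (ω.map (leftOp cs β)).prod (Finsupp.single 1 1) = Finsupp.single (cs.wordProd ω) 1 := by
  induction ω with
  | nil => simp
  | cons i ω ih =>
    have h' := isReduced_tail cs h
    rw [List.map_cons, List.prod_cons, Module.End.mul_apply, ih h',
      leftOp_up cs β ((isReduced_cons_iff cs h').1 h), cs.wordProd_cons]

theorem rightOp_word (ω : List B) :
    ∀ v : W, cs.length (v * cs.wordProd ω) = cs.length v + ω.length →
    (ω.reverse.map (rightOp cs β)).prod (Finsupp.single v 1) =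
      Finsupp.single (v * cs.wordProd ω) 1 := by
  induction ω with
  | nil => simp
  | cons i ω ih =>
    intro v hv
    rw [List.reverse_cons, List.map_append, List.prod_append, Module.End.mul_apply]
    rw [cs.wordProd_cons, ← mul_assoc, List.length_cons] at hv
    have b1 := cs.length_mul_le (v * cs.simple i) (cs.wordProd ω)
    have b2 := cs.length_wordProd_le ω
    have b3 := cs.length_mul_simple v i
    simp only [List.map_cons, List.map_nil, List.prod_cons, List.prod_nil, mul_one]
    rw [rightOp_up cs β (by omega), ih _ (by omega), cs.wordProd_cons, mul_assoc]

/-- The hypotheses on the Coxeter system: `s_i s_j` has finite order `M i j`. -/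
structure GoodOrders : Prop where
  ne_zero : ∀ i j, M i j ≠ 0
  pow_ne : ∀ i j d, 0 < d → d < M i j → (cs.simple i * cs.simple j) ^ d ≠ 1

variable {cs}

theorem leftOp_braid (hg : GoodOrders cs) (i j : B) :
    ((braidWord M i j).map (leftOp cs β)).prod = ((braidWord M j i).map (leftOp cs β)).prod := by
  have comm : ∀ (ω η : List B), Commute ((ω.map (leftOp cs β)).prod)
      ((η.map (rightOp cs β)).prod) := by
    intro ω η
    apply Commute.list_prod_left
    intro x hx
    obtain ⟨a, _, rfl⟩ := List.mem_map.mp hx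
    apply Commute.list_prod_right
    intro y hy
    obtain ⟨b, _, rfl⟩ := List.mem_map.mp hy
    exact leftOp_rightOp cs β a b
  have base : ((braidWord M i j).map (leftOp cs β)).prod (Finsupp.single 1 1) =
      ((braidWord M j i).map (leftOp cs β)).prod (Finsupp.single 1 1) := by
    rw [leftOp_word cs β (isReduced_alternating cs hg.pow_ne i j _ le_rfl),
      leftOp_word cs β (isReduced_alternating cs hg.pow_ne j i _ le_rfl),
      cs.wordProd_braidWord_eq]
  apply Finsupp.lhom_ext
  intro w c
  obtain ⟨ω, hω, rfl⟩ := cs.exists_isReduced w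
  have e : Finsupp.single (cs.wordProd ω) c =
      c • (ω.reverse.map (rightOp cs β)).prod (Finsupp.single 1 1) := by
    rw [rightOp_word cs β ω 1 (by rw [one_mul, hω.eq, cs.length_one, zero_add]), one_mul]
    simp
  rw [e, map_smul, map_smul, ← Module.End.mul_apply, ← Module.End.mul_apply, (comm _ _).eq,
    (comm _ _).eq, Module.End.mul_apply, Module.End.mul_apply, base]

theorem leftOp_sq (i : B) : leftOp cs β i * leftOp cs β i = β • leftOp cs β i := by
  apply Finsupp.lhom_ext
  intro w c
  simp only [Module.End.mul_apply, LinearMap.smul_apply]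
  by_cases h : cs.length w < cs.length (cs.simple i * w)
  · rw [leftOp_up cs β h, leftOp_down cs β (by rw [cs.simple_mul_simple_cancel_left]; omega)]
    simp [mul_comm]
  · rw [leftOp_down cs β h, leftOp_down cs β h, Finsupp.smul_single, smul_eq_mul,
      mul_comm]

/-- The left regular representation of the idCoxeter algebra. -/
noncomputable def regRep (hg : GoodOrders cs) :
    IdCoxeter M K β →ₐ[K] Module.End K (W →₀ K) :=
  idLift β (leftOp cs β) (leftOp_sq β) (leftOp_braid β hg)

theorem uElt_eq (hg : GoodOrders cs) {ω : List B} (h : cs.IsReduced ω) :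
    (ω.map (uGen M β)).prod = uElt cs β (cs.wordProd ω) := by
  have hc := (cs.exists_isReduced (cs.wordProd ω)).choose_spec
  exact matsumoto cs hg.pow_ne hg.ne_zero (uGen M β) (uGen_braid β) _ _ _ rfl h hc.1 hc.2

theorem regRep_uElt (hg : GoodOrders cs) (w : W) :
    regRep β hg (uElt cs β w) (Finsupp.single 1 1) = Finsupp.single w 1 := by
  obtain ⟨ω, hω, rfl⟩ := cs.exists_isReduced w
  rw [← uElt_eq β hg hω, map_list_prod, List.map_map]
  rw [← leftOp_word cs β hω]
  congr 2
  apply List.map_congr_left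
  intro i _
  simp [regRep]

theorem uGen_mul_uElt_up (hg : GoodOrders cs) {i : B} {w : W}
    (h : cs.length w < cs.length (cs.simple i * w)) :
    uGen M β i * uElt cs β w = uElt cs β (cs.simple i * w) := by
  obtain ⟨ω, hω, rfl⟩ := cs.exists_isReduced w
  rw [← uElt_eq β hg hω, ← cs.wordProd_cons, ← uElt_eq β hg ((isReduced_cons_iff cs hω).2 h)]
  simp

theorem uGen_mul_uElt_down (hg : GoodOrders cs) {i : B} {w : W}
    (h : ¬ cs.length w < cs.length (cs.simple i * w)) :
    uGen M β i * uElt cs β w = β • uElt cs β w := by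
  have hw : w = cs.simple i * (cs.simple i * w) := (cs.simple_mul_simple_cancel_left i).symm
  have h1 := cs.length_simple_mul w i
  have h2 : uGen M β i * uElt cs β (cs.simple i * w) = uElt cs β w := by
    rw [uGen_mul_uElt_up β hg (by rw [← hw]; omega), ← hw]
  rw [← h2, ← mul_assoc, uGen_sq, smul_mul_assoc]

theorem uElt_one (hg : GoodOrders cs) : uElt cs β (1 : W) = 1 := by
  have := uElt_eq β hg (cs := cs) (ω := []) (by simp [CoxeterSystem.IsReduced])
  simpa using this.symm

theorem uElt_linearIndependent (hg : GoodOrders cs) :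
    LinearIndependent K (uElt (K := K) cs β) := by
  have h : LinearIndependent K (((LinearMap.applyₗ (Finsupp.single (1 : W) (1 : K))).comp
      (regRep β hg).toLinearMap) ∘ uElt cs β) := by
    convert (Finsupp.basisSingleOne (R := K) (ι := W)).linearIndependent
    funext w
    simpa using regRep_uElt β hg w
  exact h.of_comp

theorem uElt_span (hg : GoodOrders cs) :
    ⊤ ≤ Submodule.span K (Set.range (uElt (K := K) cs β)) := by
  set S := Submodule.span K (Set.range (uElt (K := K) cs β))
  have hmul : ∀ (i : B), ∀ y ∈ S, uGen M β i * y ∈ S := by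
    intro i y hy
    induction hy using Submodule.span_induction with
    | mem y hy =>
      obtain ⟨w, rfl⟩ := hy
      by_cases h : cs.length w < cs.length (cs.simple i * w)
      · rw [uGen_mul_uElt_up β hg h]
        exact Submodule.subset_span ⟨_, rfl⟩
      · rw [uGen_mul_uElt_down β hg h]
        exact S.smul_mem _ (Submodule.subset_span ⟨_, rfl⟩)
    | zero => rw [mul_zero]; exact S.zero_mem
    | add x y _ _ hx hy => rw [mul_add]; exact S.add_mem hx hy
    | smul c x _ hx => rw [mul_smul_comm]; exact S.smul_mem _ hx
  have hall : ∀ a : FreeAlgebra K B, ∀ y ∈ S, RingQuot.mkAlgHom K (IdRel M K β) a * y ∈ S := by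
    intro a
    induction a using FreeAlgebra.induction with
    | grade0 r =>
      intro y hy
      rw [AlgHom.commutes, ← Algebra.smul_def]
      exact S.smul_mem _ hy
    | grade1 i => exact hmul i
    | mul a b ha hb =>
      intro y hy
      rw [map_mul, mul_assoc]
      exact ha _ (hb _ hy)
    | add a b ha hb =>
      intro y hy
      rw [map_add, add_mul]
      exact S.add_mem (ha _ hy) (hb _ hy)
  intro x _
  obtain ⟨a, rfl⟩ := RingQuot.mkAlgHom_surjective K (IdRel M K β) x
  have := hall a 1 (uElt_one (cs := cs) β hg ▸ Submodule.subset_span ⟨1, rfl⟩)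
  rwa [mul_one] at this

/-- `{u_w}` is a basis of the idCoxeter algebra. -/
noncomputable def uBasis (hg : GoodOrders cs) : Module.Basis W K (IdCoxeter M K β) :=
  Module.Basis.mk (uElt_linearIndependent β hg) (uElt_span β hg)

@[simp] theorem uBasis_apply (hg : GoodOrders cs) (w : W) : uBasis β hg w = uElt cs β w := by
  simp [uBasis]

/-- The coefficient of `u_w` in an element of the idCoxeter algebra. -/
noncomputable def uCoeff (hg : GoodOrders cs) (w : W) (x : IdCoxeter M K β) : K :=
  (uBasis β hg).repr x w

/-- A list `[(i₁, y₁), (i₂, y₂), …]` encodes the product `h_{i₁}(y₁) h_{i₂}(y₂) ⋯` of the elements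
`h_i(y) = 1 + y u_i`. -/
noncomputable def hProd (M : CoxeterMatrix B) (β : K) (l : List (B × K)) : IdCoxeter M K β :=
  (l.map fun p => 1 + p.2 • uGen M β p.1).prod

/-- Killing the generators outside a set `S`. -/
theorem uCoeff_hProd_filter (hg : GoodOrders cs) (S : Set B) [DecidablePred (· ∈ S)] {w : W}
    (hw : w ∈ Subgroup.closure (cs.simple '' S)) (l : List (B × K)) :
    uCoeff β hg w (hProd M β l) = uCoeff β hg w (hProd M β (l.filter fun p => p.1 ∈ S)) := by
  let f : B → IdCoxeter M K β := fun i => if i ∈ S then uGen M β i else 0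
  have fmem : ∀ ω : List B, (∀ i ∈ ω, i ∈ S) → (ω.map f).prod = (ω.map (uGen M β)).prod := by
    intro ω h
    congr 1
    apply List.map_congr_left
    intro i hi
    simp [f, h i hi]
  have fnot : ∀ ω : List B, (∃ i ∈ ω, i ∉ S) → (ω.map f).prod = 0 := by
    rintro ω ⟨i, hi, hS⟩
    apply List.prod_eq_zero
    rw [List.mem_map]
    exact ⟨i, hi, by simp [f, hS]⟩
  have memalt : ∀ (i j : B) (m : ℕ), 2 ≤ m → i ∈ alternatingWord i j m ∧
      j ∈ alternatingWord i j m := by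
    intro i j m hm
    obtain ⟨k, rfl⟩ := Nat.exists_eq_add_of_le' hm
    rw [alternatingWord_succ, alternatingWord_succ]
    simp
  let κ : IdCoxeter M K β →ₐ[K] IdCoxeter M K β := idLift β f
    (by
      intro i
      by_cases h : i ∈ S
      · simp only [f, if_pos h]; exact uGen_sq β i
      · simp [f, h])
    (by
      intro i j
      by_cases hij : i = j
      · rw [hij]
      have h2 : 2 ≤ M i j := by
        have := hg.ne_zero i j
        have := M.off_diagonal i j hij
        change M i j ≠ 1 at this
        omega
      have h2' : 2 ≤ M j i := by rwa [M.symmetric]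
      by_cases hi : i ∈ S
      · by_cases hj : j ∈ S
        · have : ∀ (i j : B) (m : ℕ), i ∈ S → j ∈ S → ∀ x ∈ alternatingWord i j m, x ∈ S := by
            intro i j m
            induction m generalizing i j with
            | zero => simp [alternatingWord]
            | succ m ih =>
              intro hi hj x hx
              rw [alternatingWord_succ, List.concat_eq_append, List.mem_append,
                List.mem_singleton] at hx
              rcases hx with hx | rfl
              · exact ih j i hj hi x hx
              · exact hj
          rw [fmem _ (this i j _ hi hj), fmem _ (this j i _ hj hi)]
          exact uGen_braid β i j
        · rw [fnot _ ⟨j, (memalt i j _ h2).2, hj⟩, fnot _ ⟨j, (memalt j i _ h2').1, hj⟩]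
      · rw [fnot _ ⟨i, (memalt i j _ h2).1, hi⟩, fnot _ ⟨i, (memalt j i _ h2').2, hi⟩])
  have hκ : ∀ i, κ (uGen M β i) = f i := fun i => idLift_uGen β _ _ _ i
  have hκl : κ (hProd M β l) = hProd M β (l.filter fun p => p.1 ∈ S) := by
    induction l with
    | nil => simp [hProd]
    | cons p l ih =>
      have e : hProd M β (p :: l) = (1 + p.2 • uGen M β p.1) * hProd M β l := by simp [hProd]
      rw [e, map_mul, ih, map_add, map_smul, hκ, map_one]
      by_cases h : p.1 ∈ S
      · rw [List.filter_cons_of_pos (by simpa using h)]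
        simp [hProd, f, h]
      · rw [List.filter_cons_of_neg (by simpa using h)]
        simp [f, h]
  have hc : ((uBasis β hg).coord w).comp κ.toLinearMap = (uBasis β hg).coord w := by
    obtain ⟨ω, hω, rfl, hS⟩ := exists_reduced_in cs S hw
    apply (uBasis β hg).ext
    intro z
    obtain ⟨η, hη, rfl⟩ := cs.exists_isReduced z
    rw [LinearMap.comp_apply, AlgHom.toLinearMap_apply]
    by_cases hz : ∀ i ∈ η, i ∈ S
    · congr 1
      rw [uBasis_apply, ← uElt_eq β hg hη, map_list_prod, List.map_map, ← fmem η hz]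
      congr 1
      exact List.map_congr_left fun i _ => hκ i
    · have e2 : κ (uElt cs β (cs.wordProd η)) = 0 := by
        rw [← uElt_eq β hg hη, map_list_prod, List.map_map, ← fnot η (by simpa using hz)]
        congr 1
        exact List.map_congr_left fun i _ => hκ i
      rw [uBasis_apply, e2, map_zero]
      by_cases he : cs.wordProd η = cs.wordProd ω
      · have e1 : κ (uElt cs β (cs.wordProd η)) = uElt cs β (cs.wordProd η) := by
          rw [he, ← uElt_eq β hg hω, map_list_prod, List.map_map, ← fmem ω hS]
          congr 1
          exact List.map_congr_left fun i _ => hκ i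
        rw [← e1, e2, map_zero]
      · classical
        rw [← uBasis_apply β hg, Module.Basis.coord_apply, Module.Basis.repr_self,
          Finsupp.single_apply, if_neg he]
  rw [← hκl]
  exact (LinearMap.congr_fun hc _).symm

theorem repr_eq_regRep (hg : GoodOrders cs) (x : IdCoxeter M K β) :
    (uBasis β hg).repr x = regRep β hg x (Finsupp.single 1 1) := by
  have : (uBasis β hg).repr.toLinearMap =
      (LinearMap.applyₗ (Finsupp.single (1 : W) (1 : K))).comp (regRep β hg).toLinearMap := by
    apply (uBasis β hg).ext
    intro w
    have h1 := (uBasis β hg).repr_self w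
    have h2 := regRep_uElt β hg w
    rw [uBasis_apply] at h1
    simp only [uBasis_apply, LinearEquiv.coe_coe, LinearMap.comp_apply,
      AlgHom.toLinearMap_apply, LinearMap.applyₗ_apply_apply]
    rw [h1, h2]
  exact LinearMap.congr_fun this x

/-- Coefficients are compatible with a change of the scalars. -/
theorem map_uCoeff_hProd (hg : GoodOrders cs) (f : K →+* K) (hf : f β = β) (w : W)
    (l : List (B × K)) : f (uCoeff β hg w (hProd M β l)) =
      uCoeff β hg w (hProd M β (l.map fun p => (p.1, f p.2))) := by
  have hL : ∀ (i : B) (x : W →₀ K), Finsupp.mapRange f (map_zero f) (leftOp cs β i x) =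
      leftOp cs β i (Finsupp.mapRange f (map_zero f) x) := by
    intro i x
    induction x using Finsupp.induction_linear with
    | zero => simp
    | add x y hx hy =>
      rw [map_add, Finsupp.mapRange_add (map_add f), hx, hy, Finsupp.mapRange_add (map_add f),
        map_add]
    | single w c =>
      by_cases h : cs.length w < cs.length (cs.simple i * w)
      · rw [leftOp_up cs β h, Finsupp.mapRange_single, Finsupp.mapRange_single, leftOp_up cs β h]
      · rw [leftOp_down cs β h, Finsupp.mapRange_single, Finsupp.mapRange_single,
          leftOp_down cs β h, map_mul, hf]
  have hl : Finsupp.mapRange f (map_zero f) ((uBasis β hg).repr (hProd M β l)) =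
      (uBasis β hg).repr (hProd M β (l.map fun p => (p.1, f p.2))) := by
    simp only [repr_eq_regRep]
    induction l with
    | nil => simp [hProd]
    | cons p l ih =>
      have e : ∀ (p : B × K) (l : List (B × K)),
          regRep β hg (hProd M β (p :: l)) (Finsupp.single 1 1) =
          regRep β hg (hProd M β l) (Finsupp.single 1 1) +
            p.2 • leftOp cs β p.1 (regRep β hg (hProd M β l) (Finsupp.single 1 1)) := by
        intro p l
        simp [hProd, regRep, add_mul]
      rw [List.map_cons, e, e, ← ih, Finsupp.mapRange_add (map_add f), ← hL,
        Finsupp.mapRange_smul' p.2 (f p.2) _ (by intro x; simp)]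
  have := DFunLike.congr_fun hl w
  simpa [uCoeff] using this

end Coxeter

/-! ### Weyl groups of types `A_∞`, `B_∞`, `C_∞`, `D_∞` -/

/-- The types `A`, `B`, `C`, `D`. -/
inductive CartanType
  | A | B | C | D
  deriving DecidableEq

/-- The index set of the simple reflections: `1, 2, 3, …` for type `A` and `0, 1, 2, …` for the
types `B`, `C`, `D`. In type `D` the index `0` stands for the node usually written `1̂`
(so `s_0` in type `D` is the reflection exchanging `1` and `-2`). -/
abbrev Node (X : CartanType) : Type := {k : ℕ // X = CartanType.A → k ≠ 0}

/-- Entries of the Coxeter matrix. -/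
def coxeterEntry (X : CartanType) (i j : ℕ) : ℕ :=
  if i = j then 1
  else if (i = 0 ∧ j = 1) ∨ (i = 1 ∧ j = 0) then (if X = CartanType.D then 2 else 4)
  else if X = CartanType.D ∧ ((i = 0 ∧ j = 2) ∨ (i = 2 ∧ j = 0)) then 3
  else if i + 1 = j ∨ j + 1 = i then 3
  else 2

/-- The Coxeter matrix of type `X_∞`. -/
def coxMatrix (X : CartanType) : CoxeterMatrix (Node X) where
  M := Matrix.of fun i j => coxeterEntry X i.1 j.1
  isSymm := by
    ext i j
    simp only [Matrix.transpose_apply, Matrix.of_apply, coxeterEntry]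
    grind
  diagonal i := by simp [coxeterEntry]
  off_diagonal i j h := by
    have h' : i.1 ≠ j.1 := fun e => h (Subtype.ext e)
    simp only [Matrix.of_apply, coxeterEntry]
    grind

theorem coxMatrix_apply (X : CartanType) (i j : Node X) :
    coxMatrix X i j = coxeterEntry X i.1 j.1 := rfl

/-- The Weyl group `W(X)`, given by its Coxeter presentation. -/
abbrev Weyl (X : CartanType) : Type := (coxMatrix X).Group

/-- The Coxeter system of `W(X)`. -/
abbrev weylSystem (X : CartanType) : CoxeterSystem (coxMatrix X) (Weyl X) :=
  (coxMatrix X).toCoxeterSystem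

/-- Signed permutations: permutations `σ` of `ℤ` with `σ (-k) = - σ k`. -/
def SignedPerm : Subgroup (Equiv.Perm ℤ) where
  carrier := {σ | ∀ k, σ (-k) = -σ k}
  mul_mem' := by
    intro σ τ hσ hτ k
    simp [hτ k, hσ (τ k)]
  one_mem' := by intro k; simp
  inv_mem' := by
    intro σ hσ k
    rw [Equiv.Perm.inv_eq_iff_eq, hσ, ← Equiv.Perm.mul_apply, mul_inv_cancel, Equiv.Perm.one_apply]

/-- The signed permutation exchanging `p` and `q` (and `-p` and `-q`), where `|p| ≠ |q|`. -/
def signedSwap (p q : ℤ) : Equiv.Perm ℤ := Equiv.swap p q * Equiv.swap (-p) (-q)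

/-- The signed permutation of the simple reflection `s_k`: it exchanges `k` and `k + 1` for
`k ≥ 1`; in types `B`, `C` the reflection `s_0` exchanges `1` and `-1`; in type `D` the
reflection with index `0` exchanges `1` and `-2`, and `2` and `-1`. -/
def simplePermAux (X : CartanType) (k : ℕ) : Equiv.Perm ℤ :=
  if k = 0 then (if X = CartanType.D then signedSwap 1 (-2) else Equiv.swap 1 (-1))
  else signedSwap k (k + 1)

theorem signedSwap_mem {p q : ℤ} (hp : p ≠ 0) (hq : q ≠ 0) :
    signedSwap p q ∈ SignedPerm := by
  intro k
  simp only [signedSwap, Equiv.Perm.mul_apply, Equiv.swap_apply_def]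
  split_ifs <;> omega

theorem simplePermAux_mem (X : CartanType) (k : ℕ) : simplePermAux X k ∈ SignedPerm := by
  unfold simplePermAux
  split_ifs with h1 h2
  · exact signedSwap_mem (by norm_num) (by norm_num)
  · intro k
    simp only [Equiv.swap_apply_def]
    split_ifs <;> omega
  · exact signedSwap_mem (by omega) (by omega)

/-- The signed permutation of a simple reflection. -/
def simplePerm (X : CartanType) (i : Node X) : SignedPerm :=
  ⟨simplePermAux X i.1, simplePermAux_mem X i.1⟩

theorem simplePermAux_apply (X : CartanType) (k : ℕ) (z : ℤ) : simplePermAux X k z =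
    if k = 0 then
      (if X = CartanType.D then
        (if z = 1 then -2 else if z = -2 then 1 else if z = 2 then -1 else if z = -1 then 2 else z)
      else (if z = 1 then -1 else if z = -1 then 1 else z))
    else if z = k then (k : ℤ) + 1 else if z = k + 1 then (k : ℤ)
      else if z = -k then -(k : ℤ) - 1 else if z = -k - 1 then -(k : ℤ) else z := by
  unfold simplePermAux signedSwap
  split_ifs <;> simp only [Equiv.Perm.mul_apply, Equiv.swap_apply_def] <;> grind

theorem simplePermAux_mul_self (X : CartanType) (i : ℕ) :
    simplePermAux X i * simplePermAux X i = 1 := by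
  ext z
  rw [Equiv.Perm.mul_apply, simplePermAux_apply, simplePermAux_apply, Equiv.Perm.one_apply]
  grind

theorem conj_signedSwap {σ : Equiv.Perm ℤ} (hσ : σ ∈ SignedPerm) (hs : σ * σ = 1) (p q : ℤ) :
    σ * signedSwap p q * σ = signedSwap (σ p) (σ q) := by
  have hi : σ⁻¹ = σ := by rw [inv_eq_iff_mul_eq_one, hs]
  have h1 : ∀ k, σ (-k) = -σ k := hσ
  unfold signedSwap
  rw [← h1, ← h1, Equiv.swap_apply_apply, Equiv.swap_apply_apply, hi]
  simp only [mul_assoc, mul_assoc σ, ← mul_assoc σ σ, hs, one_mul]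

theorem simplePermAux_pos (X : CartanType) {k : ℕ} (hk : k ≠ 0) :
    simplePermAux X k = signedSwap k (k + 1) := by
  simp [simplePermAux, hk]

theorem simplePermAux_liftable_lt (X : CartanType) (i j : ℕ) (hij : i < j) :
    (simplePermAux X i * simplePermAux X j) ^ coxeterEntry X i j = 1 := by
  have hi := simplePermAux_mul_self X i
  have hj := simplePermAux_mul_self X j
  have two : simplePermAux X i * simplePermAux X j * simplePermAux X i = simplePermAux X j →
      (simplePermAux X i * simplePermAux X j) ^ 2 = 1 := by
    intro h
    rw [pow_two, ← mul_assoc, h, hj]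
  have three : simplePermAux X i * simplePermAux X j * simplePermAux X i =
      simplePermAux X j * simplePermAux X i * simplePermAux X j →
      (simplePermAux X i * simplePermAux X j) ^ 3 = 1 := by
    intro h
    calc (simplePermAux X i * simplePermAux X j) ^ 3
        = simplePermAux X i * simplePermAux X j * simplePermAux X i *
          (simplePermAux X j * simplePermAux X i * simplePermAux X j) := by
            simp only [pow_succ, pow_zero, one_mul, mul_assoc]
      _ = 1 := by
        rw [← h]
        calc _ = simplePermAux X i * (simplePermAux X j * (simplePermAux X i *
              simplePermAux X i) * simplePermAux X j) * simplePermAux X i := by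
              simp only [mul_assoc]
          _ = 1 := by rw [hi, mul_one, hj, mul_one, hi]
  have cj := conj_signedSwap (simplePermAux_mem X i) hi j (j + 1)
  rw [← simplePermAux_pos X (by omega)] at cj
  unfold coxeterEntry
  rw [if_neg (by omega)]
  split_ifs with h1 h2 h3 h4
  · apply two
    obtain ⟨rfl, rfl⟩ : i = 0 ∧ j = 1 := by omega
    rw [cj]
    ext z
    rw [simplePermAux_apply X 0, simplePermAux_apply X 0, simplePermAux_apply X 1]
    simp only [signedSwap, Equiv.Perm.mul_apply, Equiv.swap_apply_def]
    grind
  · obtain ⟨rfl, rfl⟩ : i = 0 ∧ j = 1 := by omega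
    have e : ∀ z, (simplePermAux X 0 * simplePermAux X 1) z = if z = 1 then 2 else
        if z = 2 then -1 else if z = -1 then -2 else if z = -2 then 1 else z := by
      intro z
      rw [Equiv.Perm.mul_apply, simplePermAux_apply, simplePermAux_apply]
      grind
    ext z
    generalize simplePermAux X 0 * simplePermAux X 1 = c at e ⊢
    simp only [pow_succ, pow_zero, one_mul, Equiv.Perm.mul_apply, e, Equiv.Perm.one_apply]
    grind
  · apply three
    obtain ⟨rfl, rfl⟩ : i = 0 ∧ j = 2 := by omega
    have ci := conj_signedSwap (simplePermAux_mem X 2) hj 1 (-2)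
    have : simplePermAux X 0 = signedSwap 1 (-2) := by simp [simplePermAux, h3.1]
    rw [← this] at ci
    rw [cj, ci]
    ext z
    rw [simplePermAux_apply X 0, simplePermAux_apply X 0, simplePermAux_apply X 2,
      simplePermAux_apply X 2]
    simp only [signedSwap, Equiv.Perm.mul_apply, Equiv.swap_apply_def]
    grind
  · apply three
    have hi0 : i ≠ 0 := by omega
    have ci := conj_signedSwap (simplePermAux_mem X j) hj i (i + 1)
    rw [← simplePermAux_pos X hi0] at ci
    rw [cj, ci, simplePermAux_apply X i, simplePermAux_apply X i, simplePermAux_apply X j,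
      simplePermAux_apply X j]
    congr 1 <;> grind
  · apply two
    rw [cj, simplePermAux_apply X i, simplePermAux_apply X i, simplePermAux_pos X (by omega)]
    congr 1 <;> grind

theorem coxeterEntry_comm (X : CartanType) (i j : ℕ) :
    coxeterEntry X i j = coxeterEntry X j i := by
  simp only [coxeterEntry]; grind

theorem simplePerm_liftable (X : CartanType) : (coxMatrix X).IsLiftable (simplePerm X) := by
  intro i j
  apply Subtype.ext
  rw [SubmonoidClass.coe_pow, Subgroup.coe_mul, Subgroup.coe_one, coxMatrix_apply]
  change (simplePermAux X i.1 * simplePermAux X j.1) ^ _ = 1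
  rcases lt_trichotomy i.1 j.1 with h | h | h
  · exact simplePermAux_liftable_lt X _ _ h
  · rw [h, simplePermAux_mul_self, one_pow]
  · have e := simplePermAux_liftable_lt X _ _ h
    rw [coxeterEntry_comm] at e
    rw [← inv_eq_one, ← inv_pow, mul_inv_rev,
      inv_eq_of_mul_eq_one_left (simplePermAux_mul_self X i.1),
      inv_eq_of_mul_eq_one_left (simplePermAux_mul_self X j.1), e]

/-- The realization of the elements of `W(X)` as signed permutations. -/
noncomputable def signedPerm (X : CartanType) : Weyl X →* SignedPerm :=
  (weylSystem X).lift ⟨simplePerm X, simplePerm_liftable X⟩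

@[simp] theorem signedPerm_simple (X : CartanType) (i : Node X) :
    signedPerm X ((weylSystem X).simple i) = simplePerm X i :=
  (weylSystem X).lift_apply_simple (simplePerm_liftable X) i

theorem weyl_goodOrders (X : CartanType) : GoodOrders (weylSystem X) where
  ne_zero i j := by
    rw [coxMatrix_apply]
    unfold coxeterEntry
    split_ifs <;> simp
  pow_ne i j d hd hdm := by
    intro h
    have h1 : (simplePermAux X i.1 * simplePermAux X j.1) ^ d = 1 := by
      have := congrArg (signedPerm X) h
      rw [map_pow, map_mul, signedPerm_simple, signedPerm_simple, map_one] at this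
      exact congrArg Subtype.val this
    have hij : i.1 ≠ j.1 := by
      intro e
      rw [coxMatrix_apply, e, coxeterEntry, if_pos rfl] at hdm
      omega
    rw [coxMatrix_apply] at hdm
    generalize i.1 = a at *
    generalize j.1 = b at *
    have h2 := DFunLike.congr_fun h1 ((max a b : ℕ) + 1 : ℤ)
    have hd4 : d ≤ 3 := by
      unfold coxeterEntry at hdm
      split_ifs at hdm <;> omega
    have hd' : d = 1 ∨ d = 2 ∨ d = 3 := by omega
    have hP := simplePermAux_apply X
    rcases hd' with rfl | rfl | rfl
    · simp only [pow_succ, pow_zero, one_mul, Equiv.Perm.mul_apply, Equiv.Perm.one_apply] at h2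
      rcases lt_or_gt_of_ne hij with hlt | hlt
      · rw [max_eq_right hlt.le, hP b] at h2
        grind
      · rw [max_eq_left hlt.le, hP b] at h2
        grind
    · simp only [pow_succ, pow_zero, one_mul, Equiv.Perm.mul_apply, Equiv.Perm.one_apply] at h2
      have hc : (a = 0 ∧ b = 1) ∨ (a = 1 ∧ b = 0) ∨
          (X = CartanType.D ∧ ((a = 0 ∧ b = 2) ∨ (a = 2 ∧ b = 0))) ∨ a + 1 = b ∨ b + 1 = a := by
        unfold coxeterEntry at hdm
        grind
      have hX : X = CartanType.D → ¬ (a = 0 ∧ b = 1) ∧ ¬ (a = 1 ∧ b = 0) := by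
        unfold coxeterEntry at hdm
        grind
      have e1 := hP b ((max a b : ℕ) + 1 : ℤ)
      have e2 := hP a (simplePermAux X b ((max a b : ℕ) + 1 : ℤ))
      have e3 := hP b (simplePermAux X a (simplePermAux X b ((max a b : ℕ) + 1 : ℤ)))
      have e4 := hP a (simplePermAux X b (simplePermAux X a
        (simplePermAux X b ((max a b : ℕ) + 1 : ℤ))))
      rw [h2] at e4
      generalize simplePermAux X b (simplePermAux X a (simplePermAux X b _)) = x3 at *
      generalize simplePermAux X a (simplePermAux X b _) = x2 at *
      generalize simplePermAux X b _ = x1 at *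
      clear h h1 hP h2 hdm
      rcases hc with ⟨rfl, rfl⟩ | ⟨rfl, rfl⟩ | ⟨hD, ⟨rfl, rfl⟩ | ⟨rfl, rfl⟩⟩ | rfl | rfl
      · norm_num at e1 e2 e3 e4; grind
      · norm_num at e1 e2 e3 e4; grind
      · norm_num at e1 e2 e3 e4; grind
      · norm_num at e1 e2 e3 e4; grind
      · rw [max_eq_right (by omega)] at e1 e4
        by_cases ha : a = 0
        · subst ha; norm_num at e1 e2 e3 e4 hX; grind
        · simp only [if_neg ha, if_neg (Nat.succ_ne_zero a)] at e1 e2 e3 e4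
          push_cast at e1 e2 e3 e4
          have f1 : x1 = a + 1 := by grind
          have f2 : x2 = a := by grind
          have f3 : x3 = a := by grind
          grind
      · rw [max_eq_left (by omega)] at e1 e4
        by_cases hb : b = 0
        · subst hb; norm_num at e1 e2 e3 e4 hX; grind
        · simp only [if_neg hb, if_neg (Nat.succ_ne_zero b)] at e1 e2 e3 e4
          push_cast at e1 e2 e3 e4
          have f1 : x1 = b + 2 := by grind
          have f2 : x2 = b + 1 := by grind
          have f3 : x3 = b := by grind
          grind
    · have hc : (X ≠ CartanType.D) ∧ ((a = 0 ∧ b = 1) ∨ (a = 1 ∧ b = 0)) := by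
        unfold coxeterEntry at hdm
        grind
      obtain ⟨hX, ⟨rfl, rfl⟩ | ⟨rfl, rfl⟩⟩ := hc
      · norm_num [pow_succ, hP, hX] at h2
      · norm_num [pow_succ, hP, hX] at h2

/-! ### The coefficient ring `R^{b, b̄}` -/

/-- The ring `ℤ[β]`; the indeterminate `β` is `Polynomial.X`. -/
abbrev Zbeta : Type := Polynomial ℤ

/-- The element `β` of a `ℤ[β]`-algebra. -/
noncomputable def beta (K : Type*) [CommRing K] [Algebra Zbeta K] : K :=
  algebraMap Zbeta K Polynomial.X

/-- `x ⊕ y = x + y + β x y`. -/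
noncomputable def oplus {K : Type*} [CommRing K] [Algebra Zbeta K] (x y : K) : K :=
  x + y + beta K * x * y

/-- The relations `b_0 = 0` (a dummy variable) and `b_k ⊕ b_{-k} = 0`. -/
noncomputable def bRelations : Ideal (MvPolynomial ℤ Zbeta) :=
  Ideal.span ({MvPolynomial.X 0} ∪
    Set.range fun k : ℤ => oplus (MvPolynomial.X k) (MvPolynomial.X (-k)))

/-- The ring `R^{b, b̄} = ℤ[β][b_1, b̄_1, b_2, b̄_2, …]` with `b̄_k = ⊖ b_k = - b_k / (1 + β b_k)`;
here `b_{-k}` stands for `b̄_k`. Since `(1 + β b_k) (1 + β b_{-k}) = 1` follows from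
`b_k ⊕ b_{-k} = 0`, this is the localization of `ℤ[β][b_1, b_2, …]` at the elements
`1 + β b_k`. -/
def Rb : Type := MvPolynomial ℤ Zbeta ⧸ bRelations

noncomputable instance : CommRing Rb := inferInstanceAs (CommRing (MvPolynomial ℤ Zbeta ⧸ bRelations))

noncomputable instance : Algebra Zbeta Rb :=
  inferInstanceAs (Algebra Zbeta (MvPolynomial ℤ Zbeta ⧸ bRelations))

/-- The quotient map onto `R^{b, b̄}`. -/
noncomputable def Rb.mk : MvPolynomial ℤ Zbeta →ₐ[Zbeta] Rb := Ideal.Quotient.mkₐ Zbeta bRelations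

theorem Rb.mk_surjective : Function.Surjective Rb.mk := Ideal.Quotient.mk_surjective

theorem Rb.mk_eq_zero {p : MvPolynomial ℤ Zbeta} (hp : p ∈ bRelations) : Rb.mk p = 0 :=
  Ideal.Quotient.eq_zero_iff_mem.mpr hp

/-- The element `b_k`, with the convention `b_{-k} = b̄_k`. -/
noncomputable def bvar (k : ℤ) : Rb := Rb.mk (MvPolynomial.X k)

theorem bvar_zero : bvar 0 = 0 := Rb.mk_eq_zero (Ideal.subset_span (Or.inl rfl))

theorem bvar_oplus_neg (k : ℤ) : oplus (bvar k) (bvar (-k)) = 0 := by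
  have h := Rb.mk_eq_zero (Ideal.subset_span (Or.inr ⟨k, rfl⟩))
  simpa [oplus, bvar, beta] using h

/-- The action of a signed permutation on `R^{b, b̄}`: `σ (b_k) = b_{σ(k)}`. -/
noncomputable def bAct (σ : SignedPerm) : Rb →ₐ[Zbeta] Rb :=
  Ideal.Quotient.liftₐ bRelations (Rb.mk.comp (MvPolynomial.rename (σ : Equiv.Perm ℤ))) (by
    have hσ : ∀ k, (σ : Equiv.Perm ℤ) (-k) = -(σ : Equiv.Perm ℤ) k := σ.2
    intro p hp
    change p ∈ RingHom.ker _
    revert p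
    change bRelations ≤ RingHom.ker _
    rw [bRelations, Ideal.span_le]
    rintro _ (rfl | ⟨k, rfl⟩)
    · have h0 : (σ : Equiv.Perm ℤ) 0 = 0 := by
        have := hσ 0
        rw [neg_zero] at this
        omega
      have := bvar_zero
      simpa [RingHom.mem_ker, h0, bvar] using this
    · have := bvar_oplus_neg ((σ : Equiv.Perm ℤ) k)
      simpa [RingHom.mem_ker, hσ, bvar, oplus, beta] using this)

@[simp] theorem bAct_bvar (σ : SignedPerm) (k : ℤ) :
    bAct σ (bvar k) = bvar ((σ : Equiv.Perm ℤ) k) := by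
  refine (Ideal.Quotient.lift_mk bRelations _ _).trans ?_
  simp [bvar]

theorem Rb.algHom_ext {A : Type*} [CommRing A] [Algebra Zbeta A] {f g : Rb →ₐ[Zbeta] A}
    (h : ∀ k, f (bvar k) = g (bvar k)) : f = g := by
  have : f.comp Rb.mk = g.comp Rb.mk := MvPolynomial.algHom_ext fun k => h k
  ext x
  obtain ⟨p, rfl⟩ := Rb.mk_surjective x
  exact DFunLike.congr_fun this p

noncomputable instance : MulSemiringAction SignedPerm Rb where
  smul σ x := bAct σ x
  one_smul x := by
    change bAct 1 x = x
    have : bAct 1 = AlgHom.id Zbeta Rb := Rb.algHom_ext (by simp)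
    rw [this, AlgHom.id_apply]
  mul_smul σ τ x := by
    change bAct (σ * τ) x = bAct σ (bAct τ x)
    have : bAct (σ * τ) = (bAct σ).comp (bAct τ) := Rb.algHom_ext (by simp)
    rw [this, AlgHom.comp_apply]
  smul_zero σ := map_zero (bAct σ)
  smul_add σ := map_add (bAct σ)
  smul_one σ := map_one (bAct σ)
  smul_mul σ := map_mul (bAct σ)

/-- The action `w ↦ w^{(b)}` of the Weyl group on `R^{b, b̄}`. -/
noncomputable instance weylAction (X : CartanType) : MulSemiringAction (Weyl X) Rb :=
  MulSemiringAction.compHom Rb (signedPerm X)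

@[simp] theorem weyl_smul_bvar (X : CartanType) (w : Weyl X) (k : ℤ) :
    w • bvar k = bvar ((signedPerm X w : Equiv.Perm ℤ) k) :=
  bAct_bvar _ _

theorem weyl_smul_algebraMap (X : CartanType) (w : Weyl X) (c : Zbeta) :
    w • algebraMap Zbeta Rb c = algebraMap Zbeta Rb c :=
  (bAct (signedPerm X w)).commutes c

/-- The element `α_i(b)`: `b_i ⊕ b̄_{i+1}` for `i ≥ 1`, and `b̄_1`, `b̄_1 ⊕ b̄_1`, `b̄_1 ⊕ b̄_2` for the
index `0` in the types `B`, `C`, `D`. (There is no index `0` in type `A`.) -/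
noncomputable def alpha (X : CartanType) (i : Node X) : Rb :=
  if i.1 = 0 then
    match X with
    | .A => 0
    | .B => bvar (-1)
    | .C => oplus (bvar (-1)) (bvar (-1))
    | .D => oplus (bvar (-1)) (bvar (-2))
  else oplus (bvar i.1) (bvar (-(i.1 + 1)))

/-! ### The generating functions -/

/-- The index `k` of the simple reflection `s_k`, for `k ≥ 1`. -/
def nodePos (X : CartanType) (k : ℕ) : Node X := ⟨max k 1, fun _ => by omega⟩

section Words

variable {K : Type*}

/-- The factors of `A_i^{(n)}(y) = h_{n-1}(y) h_{n-2}(y) ⋯ h_i(y)`. -/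
def wordA (X : CartanType) (n i : ℕ) (y : K) : List (Node X × K) :=
  (List.Ico i n).reverse.map fun k => (nodePos X k, y)

/-- The factors of `h_i(y) h_{i+1}(y) ⋯ h_{n-1}(y)`. -/
def wordA' (X : CartanType) (n i : ℕ) (y : K) : List (Node X × K) :=
  (List.Ico i n).map fun k => (nodePos X k, y)

/-- The factors of `F_n^X(y)`, which is
`h_{n-1} ⋯ h_1 h_0 h_1 ⋯ h_{n-1}` in type `B`,
`h_{n-1} ⋯ h_1 h_0 ^ 2 h_1 ⋯ h_{n-1}` in type `C`, and
`h_{n-1} ⋯ h_2 h_1 h_{1̂} h_2 ⋯ h_{n-1}` in type `D` (`n ≥ 2`), at the argument `y`.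
It is absent in type `A`. -/
def wordF : (X : CartanType) → ℕ → K → List (Node X × K)
  | .A, _, _ => []
  | .B, n, y => wordA .B n 1 y ++ [(⟨0, by simp⟩, y)] ++ wordA' .B n 1 y
  | .C, n, y => wordA .C n 1 y ++ [(⟨0, by simp⟩, y), (⟨0, by simp⟩, y)] ++ wordA' .C n 1 y
  | .D, n, y => if n < 2 then [] else
      wordA .D n 2 y ++ [(nodePos .D 1, y), (⟨0, by simp⟩, y)] ++ wordA' .D n 2 y

/-- The factors of `G_{A_{n-1}}(y) = A_1^{(n)}(y_1) A_2^{(n)}(y_2) ⋯ A_{n-1}^{(n)}(y_{n-1})`. -/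
def wordGA (X : CartanType) (n : ℕ) (y : ℕ → K) : List (Node X × K) :=
  (List.Ico 1 n).flatMap fun i => wordA X n i (y i)

/-- The factors of
`G_n^X(a, b; x) = G_{A_{n-1}}(b̄)⁻¹ F_n^X(x_1) ⋯ F_n^X(x_n) G_{A_{n-1}}(a)`.
As `h_i(b̄)⁻¹ = h_i(b)`, the inverse `G_{A_{n-1}}(b̄)⁻¹` is the product of the factors of
`G_{A_{n-1}}(b)` in the reverse order, see `wordGA_reverse_inverse`. -/
def wordG (X : CartanType) (n : ℕ) (a b x : ℕ → K) : List (Node X × K) :=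
  (wordGA X n b).reverse ++ (List.Ico 1 (n + 1)).flatMap (fun i => wordF X n (x i)) ++ wordGA X n a

theorem wordGA_eq_map (X : CartanType) (n : ℕ) (y : ℕ → K) :
    wordGA X n y = (wordGA X n (fun i : ℕ => i)).map fun q => (q.1, y q.2) := by
  simp [wordGA, wordA, List.map_flatMap, Function.comp_def]

theorem wordF_map {K' : Type*} (f : K → K') (X : CartanType) (n : ℕ) (y : K) :
    (wordF X n y).map (fun p => (p.1, f p.2)) = wordF X n (f y) := by
  cases X <;> simp [wordF, wordA, wordA', Function.comp_def]
  split_ifs <;> simp [Function.comp_def]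

theorem wordG_map {K' : Type*} (f : K → K') (X : CartanType) (n : ℕ) (a b x : ℕ → K) :
    (wordG X n a b x).map (fun p => (p.1, f p.2)) =
      wordG X n (fun i => f (a i)) (fun i => f (b i)) (fun i => f (x i)) := by
  rw [wordG, wordG, List.map_append, List.map_append, List.map_reverse, List.map_flatMap]
  simp only [wordF_map]
  rw [wordGA_eq_map X n a, wordGA_eq_map X n b, wordGA_eq_map X n (fun i => f (a i)),
    wordGA_eq_map X n (fun i => f (b i))]
  simp [Function.comp_def]

end Words

theorem hProd_append {B : Type*} (M : CoxeterMatrix B) {K : Type*} [CommRing K] (β : K)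
    (l l' : List (B × K)) : hProd M β (l ++ l') = hProd M β l * hProd M β l' := by
  simp [hProd]

theorem hProd_zero {B : Type*} (M : CoxeterMatrix B) {K : Type*} [CommRing K] (β : K)
    (l : List (B × K)) (h : ∀ p ∈ l, p.2 = 0) : hProd M β l = 1 := by
  rw [hProd]
  apply List.prod_eq_one
  intro z hz
  obtain ⟨p, hp, rfl⟩ := List.mem_map.mp hz
  simp [h p hp]

/-- `h_i(y) h_i(ȳ) = 1`, for products: the word of `b` in reverse order inverts the word of `b̄`. -/
theorem hProd_reverse_mul {B : Type*} (M : CoxeterMatrix B) {K : Type*} [CommRing K] (β : K)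
    {J : Type*} (l : List (B × J)) (y z : J → K) (h : ∀ j, y j + z j + β * y j * z j = 0) :
    hProd M β (l.map fun q => (q.1, y q.2)).reverse * hProd M β (l.map fun q => (q.1, z q.2)) = 1 ∧
    hProd M β (l.map fun q => (q.1, z q.2)) *
      hProd M β (l.map fun q => (q.1, y q.2)).reverse = 1 := by
  have one : ∀ (i : B) (s t : K), s + t + β * s * t = 0 →
      (1 + s • uGen M β i) * (1 + t • uGen M β i) = 1 := by
    intro i s t hst
    have e : (1 + s • uGen M β i) * (1 + t • uGen M β i) =
        1 + (s + t + β * s * t) • uGen M β i := by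
      simp only [add_mul, mul_add, one_mul, mul_one, smul_mul_smul_comm, uGen_sq, add_smul,
        smul_smul]
      rw [show s * t * β = β * s * t by ring]
      abel
    rw [e, hst, zero_smul, add_zero]
  induction l with
  | nil => simp [hProd]
  | cons q l ih =>
    have e1 : hProd M β ((q :: l).map fun q => (q.1, y q.2)).reverse =
        hProd M β (l.map fun q => (q.1, y q.2)).reverse * (1 + y q.2 • uGen M β q.1) := by
      rw [List.map_cons, List.reverse_cons, hProd_append]
      simp [hProd]
    have e2 : hProd M β ((q :: l).map fun q => (q.1, z q.2)) =
        (1 + z q.2 • uGen M β q.1) * hProd M β (l.map fun q => (q.1, z q.2)) := by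
      simp [hProd]
    have h1 := one q.1 _ _ (h q.2)
    have h2 := one q.1 (z q.2) (y q.2) (by rw [← h q.2]; ring)
    rw [e1, e2]
    constructor
    · rw [mul_assoc, ← mul_assoc (1 + y q.2 • _), h1, one_mul, ih.1]
    · rw [mul_assoc, ← mul_assoc (hProd M β _) (hProd M β _), ih.2, one_mul, h2]

/-- `G_{A_{n-1}}(b̄)` is invertible, with the inverse that is used in `wordG`. -/
theorem wordGA_reverse_inverse (X : CartanType) (n : ℕ) {K : Type*} [CommRing K]
    [Algebra Zbeta K] (b c : ℕ → K) (h : ∀ i, oplus (b i) (c i) = 0) :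
    hProd (coxMatrix X) (beta K) (wordGA X n b).reverse *
      hProd (coxMatrix X) (beta K) (wordGA X n c) = 1 ∧
    hProd (coxMatrix X) (beta K) (wordGA X n c) *
      hProd (coxMatrix X) (beta K) (wordGA X n b).reverse = 1 := by
  rw [wordGA_eq_map X n b, wordGA_eq_map X n c]
  exact hProd_reverse_mul _ _ _ b c h

/-! ### Double Grothendieck polynomials -/

/-- The ring of polynomials in `a_1, a_2, …` (variables `Sum.inl`) and `x_1, x_2, …`
(variables `Sum.inr`) with coefficients in `R^{b, b̄}`; the variables `a_k`, `x_k` have the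
index `k - 1`. -/
abbrev PolyRing : Type := MvPolynomial (ℕ ⊕ ℕ) Rb

/-- The variable `a_k`, `k ≥ 1`. -/
noncomputable def aVar (k : ℕ) : PolyRing := MvPolynomial.X (Sum.inl (k - 1))

/-- The variable `x_k`, `k ≥ 1`. -/
noncomputable def xVar (k : ℕ) : PolyRing := MvPolynomial.X (Sum.inr (k - 1))

/-- The element `b_k`, `k ≥ 1`, as a constant polynomial. -/
noncomputable def bConst (k : ℕ) : PolyRing := MvPolynomial.C (bvar k)

/-- The generating function `G_n^X(a, b; x)`, an element of the idCoxeter algebra with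
coefficients extended to `R^{b, b̄}[a, x]`. -/
noncomputable def genFun (X : CartanType) (n : ℕ) :
    IdCoxeter (coxMatrix X) PolyRing (beta PolyRing) :=
  hProd (coxMatrix X) (beta PolyRing) (wordG X n aVar bConst xVar)

/-- The polynomial `𝒢^X_{n,w}(a, b; x)`: the coefficient of `u_w` in `G_n^X(a, b; x)`. -/
noncomputable def grothFin (X : CartanType) (n : ℕ) (w : Weyl X) : PolyRing :=
  uCoeff (beta PolyRing) (weyl_goodOrders X) w (genFun X n)

/-- The indices of the simple reflections of `W(X_n)`. (`W(D_n)` is trivial for `n < 2`.) -/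
def nodesFin (X : CartanType) (n : ℕ) : Set (Node X) :=
  {i | i.1 < n ∧ (X = CartanType.D → 2 ≤ n)}

/-- The parabolic subgroup `W(X_n)` of `W(X)`. -/
def weylFin (X : CartanType) (n : ℕ) : Subgroup (Weyl X) :=
  Subgroup.closure ((weylSystem X).simple '' nodesFin X n)

theorem weylFin_mono (X : CartanType) {m n : ℕ} (h : m ≤ n) : weylFin X m ≤ weylFin X n := by
  apply Subgroup.closure_mono
  apply Set.image_mono
  rintro i ⟨h1, h2⟩
  exact ⟨by omega, fun hX => (h2 hX).trans h⟩

theorem exists_mem_weylFin (X : CartanType) (w : Weyl X) : ∃ n, w ∈ weylFin X n := by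
  induction w using (weylSystem X).simple_induction_left with
  | one => exact ⟨0, one_mem _⟩
  | mul_simple_left w i ih =>
    obtain ⟨n, hn⟩ := ih
    refine ⟨max n (i.1 + 2), mul_mem ?_ (weylFin_mono X (le_max_left _ _) hn)⟩
    apply Subgroup.subset_closure
    exact ⟨i, ⟨by omega, fun _ => by omega⟩, rfl⟩

/-- The least `n` with `w ∈ W(X_n)`. -/
noncomputable def rankOf (X : CartanType) (w : Weyl X) : ℕ := sInf {n | w ∈ weylFin X n}

theorem mem_weylFin_rankOf (X : CartanType) (w : Weyl X) : w ∈ weylFin X (rankOf X w) :=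
  Nat.sInf_mem (exists_mem_weylFin X w)

/-- The substitution `x_k = 0` for all `k > n`. -/
noncomputable def trunc (n : ℕ) : PolyRing →ₐ[Rb] PolyRing :=
  MvPolynomial.aeval (Sum.elim (fun i => MvPolynomial.X (Sum.inl i))
    (fun j => if j < n then MvPolynomial.X (Sum.inr j) else 0))

theorem trunc_trunc {m n : ℕ} (h : m ≤ n) (p : PolyRing) : trunc m (trunc n p) = trunc m p := by
  have : (trunc m).comp (trunc n) = trunc m := by
    apply MvPolynomial.algHom_ext
    rintro (i | j)
    · simp [trunc]
    · simp only [trunc, AlgHom.comp_apply, MvPolynomial.aeval_X, Sum.elim_inr]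
      by_cases h1 : j < n
      · simp [h1]
      · simp [h1, show ¬ j < m by omega]
  exact DFunLike.congr_fun this p

theorem trunc_beta (n : ℕ) : trunc n (beta PolyRing) = beta PolyRing := by
  rw [beta, IsScalarTower.algebraMap_apply Zbeta Rb PolyRing]
  exact (trunc n).commutes _

theorem filter_wordA {K : Type*} (X : CartanType) (n i : ℕ) (y : K)
    [DecidablePred (· ∈ nodesFin X n)] :
    (wordA X (n + 1) i y).filter (fun p => p.1 ∈ nodesFin X n) =
      (wordA X n i y).filter (fun p => p.1 ∈ nodesFin X n) := by
  by_cases h : i ≤ n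
  · rw [wordA, List.Ico.succ_top h, List.reverse_append, List.map_append, List.filter_append]
    simp [wordA, nodesFin, nodePos]
  · rw [wordA, wordA, List.Ico.eq_nil_of_le (by omega), List.Ico.eq_nil_of_le (by omega)]

theorem filter_wordA' {K : Type*} (X : CartanType) (n i : ℕ) (y : K)
    [DecidablePred (· ∈ nodesFin X n)] :
    (wordA' X (n + 1) i y).filter (fun p => p.1 ∈ nodesFin X n) =
      (wordA' X n i y).filter (fun p => p.1 ∈ nodesFin X n) := by
  by_cases h : i ≤ n
  · rw [wordA', List.Ico.succ_top h, List.map_append, List.filter_append]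
    simp [wordA', nodesFin, nodePos]
  · rw [wordA', wordA', List.Ico.eq_nil_of_le (by omega), List.Ico.eq_nil_of_le (by omega)]

theorem filter_wordGA {K : Type*} (X : CartanType) (n : ℕ) (y : ℕ → K)
    [DecidablePred (· ∈ nodesFin X n)] :
    (wordGA X (n + 1) y).filter (fun p => p.1 ∈ nodesFin X n) =
      (wordGA X n y).filter (fun p => p.1 ∈ nodesFin X n) := by
  rw [wordGA, wordGA, List.filter_flatMap, List.filter_flatMap]
  simp only [filter_wordA]
  by_cases h : 1 ≤ n
  · rw [List.Ico.succ_top h, List.flatMap_append]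
    simp [wordA]
  · rw [List.Ico.eq_nil_of_le (by omega), List.Ico.eq_nil_of_le (by omega)]

theorem filter_wordF {K : Type*} (X : CartanType) (n : ℕ) (y : K)
    [DecidablePred (· ∈ nodesFin X n)] :
    (wordF X (n + 1) y).filter (fun p => p.1 ∈ nodesFin X n) =
      (wordF X n y).filter (fun p => p.1 ∈ nodesFin X n) := by
  cases X with
  | A => rfl
  | B => simp only [wordF, List.filter_append, filter_wordA, filter_wordA']
  | C => simp only [wordF, List.filter_append, filter_wordA, filter_wordA']
  | D =>
    by_cases h : 2 ≤ n
    · rw [wordF, wordF, if_neg (by omega), if_neg (by omega)]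
      simp only [List.filter_append, filter_wordA, filter_wordA']
    · have : ∀ i : Node .D, i ∉ nodesFin .D n := fun i hi => h (hi.2 rfl)
      simp [this]

theorem trunc_grothFin_eq (X : CartanType) (n k : ℕ) (w : Weyl X) :
    trunc n (grothFin X k w) = uCoeff (beta PolyRing) (weyl_goodOrders X) w
      (hProd (coxMatrix X) (beta PolyRing) (wordG X k (fun i => trunc n (aVar i))
        (fun i => trunc n (bConst i)) (fun i => trunc n (xVar i)))) := by
  have := map_uCoeff_hProd (beta PolyRing) (weyl_goodOrders X) (trunc n : PolyRing →+* PolyRing)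
    (trunc_beta n) w (wordG X k aVar bConst xVar)
  rw [grothFin, genFun]
  refine this.trans ?_
  rw [← wordG_map (fun p => trunc n p)]
  rfl

/-- Stability of the polynomials `𝒢^X_{n,w}`. -/
theorem trunc_grothFin_succ (X : CartanType) {n m : ℕ} (h : n ≤ m) {w : Weyl X}
    (hw : w ∈ weylFin X m) : trunc n (grothFin X (m + 1) w) = trunc n (grothFin X m w) := by
  classical
  rw [trunc_grothFin_eq, trunc_grothFin_eq]
  generalize (fun i => trunc n (aVar i)) = a
  generalize (fun i => trunc n (bConst i)) = b
  have hx : trunc n (xVar (m + 1)) = 0 := by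
    simp [trunc, xVar, show ¬ m < n by omega]
  generalize hxx : (fun i => trunc n (xVar i)) = x
  have hx' : x (m + 1) = 0 := by rw [← hxx]; exact hx
  have e : hProd (coxMatrix X) (beta PolyRing) (wordG X (m + 1) a b x) =
      hProd (coxMatrix X) (beta PolyRing) ((wordGA X (m + 1) b).reverse ++
        (List.Ico 1 (m + 1)).flatMap (fun i => wordF X (m + 1) (x i)) ++ wordGA X (m + 1) a) := by
    rw [wordG, List.Ico.succ_top (by omega), List.flatMap_append]
    simp only [hProd_append, List.flatMap_singleton]
    rw [hx', hProd_zero _ _ (wordF X (m + 1) (0 : PolyRing)), mul_one]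
    intro p hp
    rw [← wordF_map (fun _ : PolyRing => (0 : PolyRing)) X (m + 1) 0, List.mem_map] at hp
    obtain ⟨q, _, rfl⟩ := hp
    rfl
  rw [e, uCoeff_hProd_filter (beta PolyRing) (weyl_goodOrders X) (nodesFin X m) hw,
    uCoeff_hProd_filter (beta PolyRing) (weyl_goodOrders X) (nodesFin X m) hw (wordG X m a b x)]
  congr 2
  rw [wordG]
  simp only [List.filter_append, List.filter_reverse, filter_wordGA, List.filter_flatMap,
    filter_wordF]

theorem trunc_grothFin (X : CartanType) {n m m' : ℕ} (h : n ≤ m) (hm : m ≤ m') {w : Weyl X}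
    (hw : w ∈ weylFin X m) : trunc n (grothFin X m' w) = trunc n (grothFin X m w) := by
  induction m', hm using Nat.le_induction with
  | base => rfl
  | succ k hk ih => rw [trunc_grothFin_succ X (h.trans hk) (weylFin_mono X hk hw), ih]

/-- The inverse limit (over `n`) of the rings `R^{b, b̄}[a_1, a_2, …][x_1, …, x_n]` along the maps
`x_{n+1} ↦ 0`: sequences `(f_n)` such that `f_n` is obtained from `f_{n+1}` by setting
`x_k = 0` for `k > n`. -/
noncomputable def StableRing : Subalgebra Rb (ℕ → PolyRing) where
  carrier := {f | ∀ n, trunc n (f (n + 1)) = f n}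
  mul_mem' := by intro f g hf hg n; simp [hf n, hg n]
  add_mem' := by intro f g hf hg n; simp [hf n, hg n]
  algebraMap_mem' := by intro r n; simp

/-- The double Grothendieck polynomial `𝒢^X_w(a, b; x)`, the limit of the `𝒢^X_{n,w}(a, b; x)`:
its image in `R^{b, b̄}[a][x_1, …, x_n]` is `𝒢^X_{m,w}(a, b; x_1, …, x_n, 0, …, 0)` for every
large `m`. -/
noncomputable def groth (X : CartanType) (w : Weyl X) : StableRing :=
  ⟨fun n => trunc n (grothFin X (max n (rankOf X w)) w), by
    intro n
    rw [trunc_trunc (Nat.le_succ n)]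
    exact trunc_grothFin X (le_max_left _ _) (max_le_max_right _ (Nat.le_succ n))
      (weylFin_mono X (le_max_right _ _) (mem_weylFin_rankOf X w))⟩

/-- `𝒢^X_{n,w}` involves only the variables `x_1, …, x_n`. -/
theorem trunc_grothFin_self (X : CartanType) (n : ℕ) (w : Weyl X) :
    trunc n (grothFin X n w) = grothFin X n w := by
  have ha : (fun i => trunc n (aVar i)) = aVar := by
    funext i; simp [trunc, aVar]
  have hb : (fun i => trunc n (bConst i)) = bConst := by
    funext i
    exact (trunc n).commutes (bvar i)
  rw [trunc_grothFin_eq, ha, hb, grothFin, genFun]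
  congr 2
  rw [wordG, wordG]
  congr 2
  rw [List.flatMap_def, List.flatMap_def]
  congr 1
  apply List.map_congr_left
  intro i hi
  rw [List.Ico.mem] at hi
  have : trunc n (xVar i) = xVar i := by
    simp [trunc, xVar, show i - 1 < n by omega]
  rw [this]

/-- For `w ∈ W(X_n)` the image of `𝒢^X_w` in `R^{b, b̄}[a][x_1, …, x_n]` is `𝒢^X_{n,w}`. -/
theorem groth_apply (X : CartanType) {n : ℕ} {w : Weyl X} (hw : w ∈ weylFin X n) :
    (groth X w).1 n = grothFin X n w := by
  have h : rankOf X w ≤ n := Nat.sInf_le hw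
  rw [groth]
  simp only [max_eq_left h, trunc_grothFin_self]

/-! ### Algebraic localization map -/

/-- The substitution `a_k = b̄_{v(k)}`, and `x_k = b_{v(k)}` if `v(k) < 0`, `x_k = 0` if
`v(k) > 0` (with `b_{-k} = b̄_k`). -/
noncomputable def substAt (X : CartanType) (v : Weyl X) : PolyRing →ₐ[Rb] Rb :=
  MvPolynomial.aeval (Sum.elim
    (fun i : ℕ => bvar (-(signedPerm X v : Equiv.Perm ℤ) (i + 1)))
    (fun j : ℕ => if (signedPerm X v : Equiv.Perm ℤ) (j + 1) < 0 then
      bvar ((signedPerm X v : Equiv.Perm ℤ) (j + 1)) else 0))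

/-- The algebraic localization map `Φ^X`. The value at `v` is obtained by the substitution
`substAt X v` in `f_n` for `n` so large that `v ∈ W(X_n)`; then `x_k = 0` for `k > n`, and the
choice of `n` does not matter, see `localization_apply`. -/
noncomputable def localization (X : CartanType) : StableRing →ₐ[Rb] (Weyl X → Rb) :=
  AlgHom.pi fun v =>
    (substAt X v).comp ((Pi.evalAlgHom Rb (fun _ => PolyRing) (rankOf X v)).comp StableRing.val)

theorem simplePermAux_fix (X : CartanType) {n : ℕ} {i : Node X} (hi : i ∈ nodesFin X n) {k : ℤ}
    (hk : (n : ℤ) < k) : simplePermAux X i.1 k = k := by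
  obtain ⟨h1, h2⟩ := hi
  rw [simplePermAux_apply]
  grind

theorem signedPerm_fix (X : CartanType) {n : ℕ} {v : Weyl X} (hv : v ∈ weylFin X n) {k : ℤ}
    (hk : (n : ℤ) < k) : (signedPerm X v : Equiv.Perm ℤ) k = k := by
  induction hv using Subgroup.closure_induction with
  | mem x hx =>
    obtain ⟨i, hi, rfl⟩ := hx
    rw [signedPerm_simple]
    exact simplePermAux_fix X hi hk
  | one => simp
  | mul x y _ _ hx hy => simp [hx, hy]
  | inv x _ hx => rw [map_inv, Subgroup.coe_inv, Equiv.Perm.inv_eq_iff_eq, hx]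

theorem substAt_trunc (X : CartanType) {n : ℕ} {v : Weyl X} (hv : v ∈ weylFin X n)
    (p : PolyRing) : substAt X v (trunc n p) = substAt X v p := by
  have : (substAt X v).comp (trunc n) = substAt X v := by
    apply MvPolynomial.algHom_ext
    rintro (i | j)
    · simp [substAt, trunc]
    · simp only [trunc, AlgHom.comp_apply, MvPolynomial.aeval_X, Sum.elim_inr]
      by_cases h1 : j < n
      · simp [h1]
      · have := signedPerm_fix X hv (k := (j : ℤ) + 1) (by omega)
        simp [h1, substAt, this]
        intro h; omega
  exact DFunLike.congr_fun this p

theorem localization_apply (X : CartanType) {n : ℕ} {v : Weyl X} (hv : v ∈ weylFin X n)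
    (f : StableRing) : localization X f v = substAt X v (f.1 n) := by
  have h : rankOf X v ≤ n := Nat.sInf_le hv
  change substAt X v (f.1 (rankOf X v)) = _
  induction n, h using Nat.le_induction with
  | base => rfl
  | succ k hk ih =>
    have hk' := weylFin_mono X hk (mem_weylFin_rankOf X v)
    rw [ih hk', ← f.2 k, substAt_trunc X hk']

/-! ### The smash product, subwords, and the Bruhat order -/

/-- The smash product `R^{b, b̄} # ℤ[W]`: the elements are the finite sums of elements
`f ⊗ w`, written `SkewMonoidAlgebra.single w f`, and `(f ⊗ v) (g ⊗ w) = f v(g) ⊗ v w`. -/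
abbrev Smash (X : CartanType) : Type := SkewMonoidAlgebra Rb (Weyl X)

/-- The `R^{b, b̄}`-linear map `ε` with `ε (f ⊗ w) = f`. -/
noncomputable def smashEps (X : CartanType) : Smash X →ₗ[Rb] Rb :=
  (Finsupp.linearCombination Rb fun _ : Weyl X => (1 : Rb)).comp
    (SkewMonoidAlgebra.coeffLinearEquiv (S := Rb) (k := Rb) (G := Weyl X)).toLinearMap

theorem smashEps_single (X : CartanType) (w : Weyl X) (f : Rb) :
    smashEps X (SkewMonoidAlgebra.single w f) = f := by
  change Finsupp.linearCombination Rb (fun _ : Weyl X => (1 : Rb)) (Finsupp.single w f) = f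
  rw [Finsupp.linearCombination_single, smul_eq_mul, mul_one]

/-- `|c| = c_1 + ⋯ + c_r`. -/
def weight {r : ℕ} (c : Fin r → Fin 2) : ℕ := ∑ k, (c k : ℕ)

open Classical in
/-- The set `C(i, w)` of the `c ∈ {0,1}^r` such that the product of the `u_{i_k}` with `c_k = 1`
(in this order) is `β^{|c| - ℓ(w)} u_w` in the idCoxeter algebra over `ℤ[β]`. -/
noncomputable def subwords (X : CartanType) (i : List (Node X)) (w : Weyl X) :
    Finset (Fin i.length → Fin 2) :=
  Finset.univ.filter fun c => (weylSystem X).length w ≤ weight c ∧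
    (List.ofFn fun k => if c k = 1 then uGen (coxMatrix X) (beta Zbeta) (i.get k) else 1).prod =
      beta Zbeta ^ (weight c - (weylSystem X).length w) • uElt (weylSystem X) (beta Zbeta) w

/-- The product over `k = 1, …, r` of `α_{i_k}(b) ⊗ s_{i_k}` if `c_k = 1` and `1 ⊗ s_{i_k}` if
`c_k = 0`, in the smash product. -/
noncomputable def smashProd (X : CartanType) (i : List (Node X)) (c : Fin i.length → Fin 2) :
    Smash X :=
  (List.ofFn fun k => if c k = 1 then
      SkewMonoidAlgebra.single ((weylSystem X).simple (i.get k)) (alpha X (i.get k))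
    else SkewMonoidAlgebra.single ((weylSystem X).simple (i.get k)) (1 : Rb)).prod

/-- The Bruhat order: `w ≤ v` if `v` is obtained from `w` by successive multiplications by
reflections that increase the length. -/
def BruhatLE (X : CartanType) : Weyl X → Weyl X → Prop :=
  Relation.ReflTransGen fun x y => ∃ t, (weylSystem X).IsReflection t ∧ y = x * t ∧
    (weylSystem X).length x < (weylSystem X).length y

end KGroth

namespace KGroth

/-! Substitute the localization point `v` into the whole generating function and call the result
`G(v)`, an element of the idCoxeter algebra over `R^{b, b̄}` (`genLoc`). By `substAt_grothFin`, its
coefficient at `u_w` is the localized polynomial for `w`. The theorem follows from two facts about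
`G`:

`G(1) = 1`, because every `x_k` vanishes and `a = b̄` (`genLoc_one`); `G(v s_i) = G(v) h_i(v α_i)`
(`genLoc_mul_simple`).

Iterating along a word gives `G(v) = ∏ h_{i_k}(s_{i_1} ⋯ s_{i_{k-1}} α_{i_k})`. Expanding this
product selects a subword `c`. The group elements in the smash product record how each root is
moved, so the scalar attached to `c` is `ε` of the smash product term (`locProd_eq_sum`). The
product of the selected `u`'s is `β ^ (|c| - ℓ) u_z`, with `z` the Demazure product of the subword
and `ℓ` its length (`uGen_prod_eq`). Reading off the coefficient of `u_w` is statement (1).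

The recursion rests on the Yang–Baxter and reflection equations. Write `A_i` for the descending
products. For `i ≥ 1`, `v s_i` exchanges `v(i)` and `v(i+1)`. The factors `F_n` commute
(`fProd_commute`), and `A_i(x) A_{i+1}(y) h_i(y ⊖ x) = A_i(y) A_{i+1}(x)` (`descProd_exchange`)
produces the new factor. For the special node one or two signs change. Since `F(x̄) = F(x)⁻¹`, each
sign change inserts a factor `F`, which is carried to the right and absorbed by the leading `A`'s
(`palProd_mul_descProd`, `palProd_fork`).

For (2), take a reduced word of `v`. The Demazure product of any of its subwords is below `v`
(`demazure_selected_bruhatLE`), by the lifting property of the Bruhat order, which comes from strong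
exchange. If `w ≤ v` fails, the sum in (1) is therefore empty. -/

/-! ### Yang–Baxter and reflection equations -/

section YangBaxter

variable {K A : Type*} [CommRing K] [Ring A] [Algebra K A]

/-- The factor `h(y) = 1 + y u`. -/
def hFactor (u : A) (y : K) : A := 1 + y • u

theorem hFactor_zero (u : A) : hFactor u (0 : K) = 1 := by simp [hFactor]

theorem hFactor_mul {β : K} {u : A} (hu : u * u = β • u) {x y z : K} (h : x + y + β * x * y = z) :
    hFactor u x * hFactor u y = hFactor u z := by
  subst h
  simp only [hFactor, add_mul, mul_add, one_mul, mul_one, smul_mul_assoc, mul_smul_comm, hu]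
  module

theorem hFactor_mul_inv {β : K} {u : A} (hu : u * u = β • u) {x y : K}
    (h : x + y + β * x * y = 0) : hFactor u x * hFactor u y = 1 := by
  rw [hFactor_mul hu h, hFactor_zero]

theorem commute_hFactor {u z : A} (h : Commute z u) (x : K) : Commute z (hFactor u x) :=
  (Commute.one_right z).add_right (h.smul_right x)

theorem hFactor_comm (u : A) (x y : K) : Commute (hFactor u x) (hFactor u y) :=
  commute_hFactor ((commute_hFactor (Commute.refl u) x).symm) y

/-- The Yang–Baxter equation for a braid relation of order three. -/
theorem yangBaxter {β : K} {p q : A} (hp : p * p = β • p) (hq : q * q = β • q)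
    (hpq : p * q * p = q * p * q) {x y s : K} (hs : x + y + β * x * y = s) :
    hFactor p x * hFactor q s * hFactor p y = hFactor q y * hFactor p s * hFactor q x := by
  subst hs
  -- The expansion associates products to the right, so the braid relation must be in this form to
  -- apply.
  have hpq' : p * (q * p) = q * (p * q) := by simpa only [mul_assoc] using hpq
  simp only [hFactor, add_mul, mul_add, one_mul, mul_one, smul_mul_assoc, mul_smul_comm, mul_assoc,
    hp, hq, hpq']
  module

/-- The reflection equation with boundary factor `h_0(x)`. -/
theorem reflection_eq {β : K} {p q : A} (hp : p * p = β • p) (hq : q * q = β • q)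
    (hpq : p * q * p * q = q * p * q * p) {x t y s : K} (hy : x + t + β * x * t = y)
    (hs : x + y + β * x * y = s) :
    hFactor p x * hFactor q s * hFactor p y * hFactor q t =
      hFactor q t * hFactor p y * hFactor q s * hFactor p x := by
  subst hs
  subst hy
  have hpq' : p * (q * (p * q)) = q * (p * (q * p)) := by simpa only [mul_assoc] using hpq
  simp only [hFactor, add_mul, mul_add, one_mul, mul_one, smul_mul_assoc, mul_smul_comm, mul_assoc,
    hp, hq, hpq']
  module

/-- The reflection equation with boundary factor `h_0(x) ^ 2`. -/
theorem reflection_eq_sq {β : K} {p q : A} (hp : p * p = β • p) (hq : q * q = β • q)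
    (hpq : p * q * p * q = q * p * q * p) {x t y s : K} (hy : x + t + β * x * t = y)
    (hs : x + y + β * x * y = s) :
    hFactor p x * hFactor p x * hFactor q s * (hFactor p y * hFactor p y) * hFactor q t =
      hFactor q t * (hFactor p y * hFactor p y) * hFactor q s * (hFactor p x * hFactor p x) := by
  -- The square is the single factor with argument `x ⊕ x`, so the expansion has the same shape as
  -- in `reflection_eq`.
  rw [hFactor_mul hp (x := x) (y := x) rfl, hFactor_mul hp (x := y) (y := y) rfl]
  subst hs
  subst hy
  have hpq' : p * (q * (p * q)) = q * (p * (q * p)) := by simpa only [mul_assoc] using hpq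
  simp only [hFactor, add_mul, mul_add, one_mul, mul_one, smul_mul_assoc, mul_smul_comm, mul_assoc,
    hp, hq, hpq']
  module

/-- The reflection equation with boundary factor `h_1(x) h_{1̂}(x)`. -/
theorem reflection_eq_fork {β : K} {p r q : A} (hp : p * p = β • p) (hr : r * r = β • r)
    (hq : q * q = β • q) (hpr : Commute p r) (hpq : p * q * p = q * p * q)
    (hrq : r * q * r = q * r * q) {x t y s : K} (hy : x + t + β * x * t = y)
    (hs : x + y + β * x * y = s) :
    hFactor p x * hFactor r x * hFactor q s * (hFactor p y * hFactor r y) * hFactor q t =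
      hFactor q t * (hFactor p y * hFactor r y) * hFactor q s * (hFactor p x * hFactor r x) := by
  have c : ∀ a b : K, hFactor p a * hFactor r b = hFactor r b * hFactor p a := fun a b =>
    commute_hFactor (commute_hFactor hpr.symm a).symm b
  -- Here `s = x ⊕ y` and `y = x ⊕ t`. As `⊕` is symmetric, each Yang–Baxter equation is also
  -- available with its outer arguments exchanged. Two of them rewrite forwards and two backwards,
  -- and the commuting factors of `p` and `r` are slid past each other in between.
  have e1 := yangBaxter hp hq hpq hs
  have e1' := yangBaxter hp hq hpq (x := y) (y := x) (s := s) (by rw [← hs]; ring)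
  have e2 := yangBaxter hq hr hrq.symm hy
  have e2' := yangBaxter hq hr hrq.symm (x := t) (y := x) (s := y) (by rw [← hy]; ring)
  calc _ = hFactor r x * (hFactor p x * hFactor q s * hFactor p y) * hFactor r y * hFactor q t := by
        rw [c]; simp only [mul_assoc]
    _ = hFactor r x * hFactor q y * hFactor p s * (hFactor q x * hFactor r y * hFactor q t) := by
        rw [e1]; simp only [mul_assoc]
    _ = hFactor r x * hFactor q y * (hFactor p s * hFactor r t) * hFactor q y * hFactor r x := by
        rw [e2]; simp only [mul_assoc]
    _ = (hFactor r x * hFactor q y * hFactor r t) * hFactor p s * hFactor q y * hFactor r x := by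
        rw [c]; simp only [mul_assoc]
    _ = hFactor q t * hFactor r y * (hFactor q x * hFactor p s * hFactor q y) * hFactor r x := by
        rw [← e2']; simp only [mul_assoc]
    _ = hFactor q t * (hFactor p y * hFactor r y) * hFactor q s * (hFactor p x * hFactor r x) := by
        rw [← e1', c y y]; simp only [mul_assoc]

/-! ### Products of consecutive factors -/

/-- `h_{n-1}(y) ⋯ h_i(y)`. -/
def descProd (u : ℕ → A) (n i : ℕ) (y : K) : A :=
  ((List.Ico i n).reverse.map fun k => hFactor (u k) y).prod

/-- `h_i(y) ⋯ h_{n-1}(y)`. -/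
def ascProd (u : ℕ → A) (n i : ℕ) (y : K) : A :=
  ((List.Ico i n).map fun k => hFactor (u k) y).prod

theorem descProd_of_le (u : ℕ → A) {n i : ℕ} (h : n ≤ i) (y : K) : descProd u n i y = 1 := by
  simp [descProd, List.Ico.eq_nil_of_le h]

theorem ascProd_of_le (u : ℕ → A) {n i : ℕ} (h : n ≤ i) (y : K) : ascProd u n i y = 1 := by
  simp [ascProd, List.Ico.eq_nil_of_le h]

theorem descProd_succ (u : ℕ → A) {n i : ℕ} (h : i < n) (y : K) :
    descProd u n i y = descProd u n (i + 1) y * hFactor (u i) y := by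
  simp [descProd, List.Ico.eq_cons h]

theorem ascProd_succ (u : ℕ → A) {n i : ℕ} (h : i < n) (y : K) :
    ascProd u n i y = hFactor (u i) y * ascProd u n (i + 1) y := by
  simp [ascProd, List.Ico.eq_cons h]

/-- Passing to the opposite algebra turns identities for descending products into identities for
ascending ones. -/
theorem op_ascProd (u : ℕ → A) (n i : ℕ) (y : K) :
    MulOpposite.op (ascProd u n i y) = descProd (fun k => MulOpposite.op (u k)) n i y := by
  rw [ascProd, MulOpposite.op_list_prod, descProd, List.map_map, ← List.map_reverse]
  congr 1

theorem commute_descProd {u : ℕ → A} {n i : ℕ} {z : A} (h : ∀ k, i ≤ k → k < n → Commute z (u k))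
    (y : K) : Commute z (descProd u n i y) := by
  apply Commute.list_prod_right
  intro w hw
  obtain ⟨k, hk, rfl⟩ := List.mem_map.mp hw
  rw [List.mem_reverse, List.Ico.mem] at hk
  exact commute_hFactor (h k hk.1 hk.2) y

theorem commute_ascProd {u : ℕ → A} {n i : ℕ} {z : A} (h : ∀ k, i ≤ k → k < n → Commute z (u k))
    (y : K) : Commute z (ascProd u n i y) := by
  apply Commute.list_prod_right
  intro w hw
  obtain ⟨k, hk, rfl⟩ := List.mem_map.mp hw
  rw [List.Ico.mem] at hk
  exact commute_hFactor (h k hk.1 hk.2) y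

/-- The relations of the idCoxeter algebra of type `A` for `u_1, u_2, …`. -/
structure TypeARel (β : K) (u : ℕ → A) : Prop where
  sq : ∀ k, 1 ≤ k → u k * u k = β • u k
  braid : ∀ k, 1 ≤ k → u k * u (k + 1) * u k = u (k + 1) * u k * u (k + 1)
  comm : ∀ k l, 1 ≤ k → k + 2 ≤ l → Commute (u k) (u l)

variable {β : K} {u : ℕ → A}

theorem TypeARel.op (H : TypeARel β u) : TypeARel β (fun k => MulOpposite.op (u k)) where
  sq k hk := by rw [← MulOpposite.op_mul, H.sq k hk, MulOpposite.op_smul]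
  braid k hk := by
    simp only [← MulOpposite.op_mul, ← mul_assoc]
    rw [H.braid k hk]
  comm k l hk hl := (H.comm k l hk hl).op

theorem ascProd_mul_descProd (H : TypeARel β u) {x y : K} (h : x + y + β * x * y = 0) {n i : ℕ}
    (hi : 1 ≤ i) : ascProd u n i x * descProd u n i y = 1 := by
  by_cases hn : n ≤ i
  · rw [ascProd_of_le u hn, descProd_of_le u hn, one_mul]
  · have := ascProd_mul_descProd H h (n := n) (i := i + 1) (by omega)
    rw [ascProd_succ u (by omega), descProd_succ u (by omega), mul_assoc,
      ← mul_assoc (ascProd _ _ _ _), this, one_mul, hFactor_mul_inv (H.sq i hi) h]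
termination_by n - i

theorem descProd_mul_ascProd (H : TypeARel β u) {x y : K} (h : x + y + β * x * y = 0) {n i : ℕ}
    (hi : 1 ≤ i) : descProd u n i x * ascProd u n i y = 1 := by
  by_cases hn : n ≤ i
  · rw [ascProd_of_le u hn, descProd_of_le u hn, one_mul]
  · have := descProd_mul_ascProd H h (n := n) (i := i + 1) (by omega)
    rw [ascProd_succ u (by omega), descProd_succ u (by omega), mul_assoc,
      ← mul_assoc (hFactor _ _), hFactor_mul_inv (H.sq i hi) h, one_mul, this]
termination_by n - i

/-- Split the last factor off the inner product on each side of `A_i(x) A_i(y) = A_i(y) A_i(x)` and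
cancel `h_i(x)` on the right; what remains of `h_i(y)` is `h_i(t)`, as `t = y ⊖ x`. Commutation is a
hypothesis because its own inductive proof uses this lemma one index higher. -/
theorem descProd_exchange_of_commute (H : TypeARel β u) {x x' t y : K}
    (hx : x + x' + β * x * x' = 0) (hy : x + t + β * x * t = y) {n i : ℕ} (hi : 1 ≤ i) (hn : i < n)
    (hc : Commute (descProd u n i x) (descProd u n i y)) :
    descProd u n i x * descProd u n (i + 1) y * hFactor (u i) t =
      descProd u n i y * descProd u n (i + 1) x := by
  have e : descProd u n i x * (descProd u n (i + 1) y * hFactor (u i) y) =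
      descProd u n i y * (descProd u n (i + 1) x * hFactor (u i) x) := by
    rw [← descProd_succ u hn, ← descProd_succ u hn, hc.eq]
  have hy' : hFactor (u i) y = hFactor (u i) t * hFactor (u i) x := by
    rw [hFactor_mul (H.sq i hi)]; rw [← hy]; ring
  rw [hy'] at e
  have hinv := hFactor_mul_inv (H.sq i hi) hx
  calc _ = descProd u n i x * (descProd u n (i + 1) y * (hFactor (u i) t * hFactor (u i) x)) *
        hFactor (u i) x' := by simp only [mul_assoc, hinv, mul_one]
    _ = _ := by rw [e]; simp only [mul_assoc, hinv, mul_one]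

/-- The products `A_i(x)` and `A_i(y)` commute. -/
theorem descProd_commute (H : TypeARel β u) {x x' t y : K}
    (hx : x + x' + β * x * x' = 0) (hy : x + t + β * x * t = y) {n i : ℕ} (hi : 1 ≤ i) :
    Commute (descProd u n i x) (descProd u n i y) := by
  by_cases hn : n ≤ i + 1
  · by_cases hn' : n ≤ i
    · rw [descProd_of_le u hn', descProd_of_le u hn']
    · have hi' : i < n := by omega
      rw [descProd_succ u hi' x, descProd_succ u hi' y, descProd_of_le u hn,
        descProd_of_le u hn, one_mul, one_mul]
      exact hFactor_comm _ _ _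
  · have hc := descProd_commute H hx hy (n := n) (i := i + 1) (by omega)
    have e := descProd_exchange_of_commute H hx hy (n := n) (i := i + 1) (by omega) (by omega) hc
    -- `u_i` commutes with all `u_k`, `k ≥ i + 2`, so the factors with index `i`, and one with index
    -- `i + 1`, can be collected on the right.
    have key : ∀ a b : K, descProd u n i a * descProd u n i b =
        descProd u n (i + 1) a * descProd u n (i + 2) b *
          (hFactor (u i) a * hFactor (u (i + 1)) b * hFactor (u i) b) := by
      intro a b
      have cm : Commute (hFactor (u i) a) (descProd u n (i + 2) b) :=
        commute_descProd (fun k h1 _ =>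
          (commute_hFactor (H.comm i k hi h1).symm a).symm) b
      rw [descProd_succ u (i := i) (by omega) a, descProd_succ u (i := i) (by omega) b,
        descProd_succ u (i := i + 1) (by omega) b]
      calc _ = descProd u n (i + 1) a * (hFactor (u i) a * descProd u n (i + 2) b) *
            (hFactor (u (i + 1)) b * hFactor (u i) b) := by simp only [mul_assoc]
        _ = _ := by rw [cm.eq]; simp only [mul_assoc]
    have yb := yangBaxter (H.sq i hi) (H.sq (i + 1) (by omega)) (H.braid i hi) hy
    rw [Commute, SemiconjBy, key, key, ← e, mul_assoc _ (hFactor _ t)]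
    congr 1
    -- Writing `h_i(y) = h_i(t) h_i(x)` exposes the left side of the Yang–Baxter equation with
    -- arguments `x, y, t`.
    calc _ = hFactor (u i) x * hFactor (u (i + 1)) y * (hFactor (u i) t * hFactor (u i) x) := by
          rw [hFactor_mul (H.sq i hi) (x := t) (y := x) (z := y) (by rw [← hy]; ring)]
      _ = _ := by rw [← mul_assoc, yb]; simp only [mul_assoc]
termination_by n - i

theorem descProd_exchange (H : TypeARel β u) {x x' t y : K}
    (hx : x + x' + β * x * x' = 0) (hy : x + t + β * x * t = y) {n i : ℕ} (hi : 1 ≤ i)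
    (hn : i < n) :
    descProd u n i x * descProd u n (i + 1) y * hFactor (u i) t =
      descProd u n i y * descProd u n (i + 1) x :=
  descProd_exchange_of_commute H hx hy hi hn (descProd_commute H hx hy hi)

theorem ascProd_exchange (H : TypeARel β u) {x x' t y : K}
    (hx : x + x' + β * x * x' = 0) (hy : x + t + β * x * t = y) {n i : ℕ} (hi : 1 ≤ i)
    (hn : i < n) :
    hFactor (u i) t * (ascProd u n (i + 1) y * ascProd u n i x) =
      ascProd u n (i + 1) x * ascProd u n i y := by
  apply MulOpposite.op_injective
  simp only [MulOpposite.op_mul, op_ascProd]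
  exact descProd_exchange H.op hx hy hi hn

/-- The ascending product at `x` is the inverse of the descending product at `x̄`, which commutes
with the descending product at `y`. -/
theorem ascProd_commute_descProd (H : TypeARel β u) {x x' s y : K}
    (hx : x + x' + β * x * x' = 0) (hs : x + y + β * x * y = s) {n i : ℕ} (hi : 1 ≤ i) :
    Commute (ascProd u n i x) (descProd u n i y) := by
  have hx' : x' + x + β * x' * x = 0 := by rw [← hx]; ring
  have hy : x' + s + β * x' * s = y := by
    rw [← hs]
    linear_combination (1 + β * y) * hx
  have c := descProd_commute H hx' hy (n := n) hi
  have a1 := ascProd_mul_descProd H hx (n := n) hi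
  have a2 := descProd_mul_ascProd H hx' (n := n) hi
  exact Commute.units_inv_left (u := ⟨descProd u n i x', ascProd u n i x, a2, a1⟩) c

/-! ### The products `F_n(x)` -/

/-- `h_{n-1}(x) ⋯ h_m(x) Z h_m(x) ⋯ h_{n-1}(x)`. -/
def palProd (u : ℕ → A) (n m : ℕ) (Z : A) (x : K) : A := descProd u n m x * Z * ascProd u n m x

/-- The two inner ramps commute. After they are interchanged, their factors of index `m` meet in
`h_m(x ⊕ y)`, and the rest moves outwards past `Z` and `Z'`. All boundary data is then isolated in
`Z h_m(x ⊕ y) Z'`. -/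
theorem palProd_mul (H : TypeARel β u) {x x' s y : K} (hx : x + x' + β * x * x' = 0)
    (hs : x + y + β * x * y = s) {n m : ℕ} (hm : 1 ≤ m) (hn : m < n) {Z Z' : A}
    (hZ : ∀ k, m < k → Commute Z (u k)) (hZ' : ∀ k, m < k → Commute Z' (u k)) :
    palProd u n m Z x * palProd u n m Z' y = descProd u n m x * descProd u n (m + 1) y *
      (Z * hFactor (u m) s * Z') * (ascProd u n (m + 1) x * ascProd u n m y) := by
  have c1 := (ascProd_commute_descProd H hx hs (n := n) hm).eq
  have c2 := (commute_descProd (n := n) (fun k h _ => hZ k h) y).eq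
  have c3 := (commute_ascProd (n := n) (fun k h _ => hZ' k h) x).eq
  have c4 := hFactor_mul (H.sq m hm) (x := y) (y := x) (z := s) (by rw [← hs]; ring)
  calc _ = descProd u n m x * Z * (ascProd u n m x * descProd u n m y) * Z' * ascProd u n m y := by
        simp only [palProd, mul_assoc]
    _ = descProd u n m x * (Z * descProd u n (m + 1) y) * (hFactor (u m) y * hFactor (u m) x) *
        (ascProd u n (m + 1) x * Z') * ascProd u n m y := by
        rw [c1, descProd_succ u hn y, ascProd_succ u hn x]; simp only [mul_assoc]
    _ = _ := by rw [c2, ← c3, c4]; simp only [mul_assoc]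

/-- The exchange relations give both orders of multiplication the same outer ramps, at the cost of a
factor `h_m(t)` next to the core. What is left to compare is the reflection equation `hr` for the
boundary. -/
theorem palProd_commute (H : TypeARel β u) {x x' y y' t s : K} (hx : x + x' + β * x * x' = 0)
    (hy' : y + y' + β * y * y' = 0)
    (hy : x + t + β * x * t = y) (hs : x + y + β * x * y = s) {n m : ℕ} (hm : 1 ≤ m) (hn : m < n)
    {Z Z' : A} (hZ : ∀ k, m < k → Commute Z (u k)) (hZ' : ∀ k, m < k → Commute Z' (u k))
    (hr : Z * hFactor (u m) s * Z' * hFactor (u m) t =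
      hFactor (u m) t * Z' * hFactor (u m) s * Z) :
    Commute (palProd u n m Z x) (palProd u n m Z' y) := by
  rw [Commute, SemiconjBy, palProd_mul H hx hs hm hn hZ hZ',
    palProd_mul H hy' (s := s) (by rw [← hs]; ring) hm hn hZ' hZ,
    ← descProd_exchange H hx hy hm hn, ← ascProd_exchange H hx hy hm hn]
  calc _ = descProd u n m x * descProd u n (m + 1) y *
        (Z * hFactor (u m) s * Z' * hFactor (u m) t) *
          (ascProd u n (m + 1) y * ascProd u n m x) := by simp only [mul_assoc]
    _ = _ := by rw [hr]; simp only [mul_assoc]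

theorem palProd_mul_inv (H : TypeARel β u) {x y : K} (h : x + y + β * x * y = 0) {n m : ℕ}
    (hm : 1 ≤ m) {Z Z' : A} (hZ : Z * Z' = 1) :
    palProd u n m Z x * palProd u n m Z' y = 1 := by
  have h1 := ascProd_mul_descProd H h (n := n) hm
  have h2 := descProd_mul_ascProd H h (n := n) hm
  calc _ = descProd u n m x * Z * (ascProd u n m x * descProd u n m y) * Z' * ascProd u n m y := by
        simp only [palProd, mul_assoc]
    _ = descProd u n m x * (Z * Z') * ascProd u n m y := by rw [h1]; simp only [mul_assoc, one_mul]
    _ = 1 := by rw [hZ, mul_one, h2]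

/-- The absorption step for a sign change: in types `B` and `C`, with `m = 1`, it turns `A_1(ȳ)`
into `A_1(y)` and emits the boundary factor. -/
theorem palProd_mul_descProd (H : TypeARel β u) {x y : K} (h : x + y + β * x * y = 0) {n m : ℕ}
    (hm : 1 ≤ m) (Z : A) : palProd u n m Z x * descProd u n m y = descProd u n m x * Z := by
  rw [palProd, mul_assoc, ascProd_mul_descProd H h hm, mul_one]

/-- In type `D` the product `F(x) F(y)` transforms `G(ȳ, x̄, …)` into `G(x, y, …) h_{1̂}(x ⊕ y)`. -/
theorem palProd_fork (H : TypeARel β u) {r : A} (hr : r * r = β • r) (hr1 : Commute r (u 1))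
    (hr2 : r * u 2 * r = u 2 * r * u 2) (hr3 : ∀ k, 3 ≤ k → Commute r (u k)) {x y x' y' s : K}
    (hx : x + x' + β * x * x' = 0) (hy : y + y' + β * y * y' = 0)
    (hs : x + y + β * x * y = s) {n : ℕ} (hn : 2 < n) :
    palProd u n 2 (hFactor (u 1) x * hFactor r x) x *
      palProd u n 2 (hFactor (u 1) y * hFactor r y) y *
      (descProd u n 1 y' * descProd u n 2 x') =
    descProd u n 1 x * descProd u n 2 y * hFactor r s := by
  have cr : ∀ a b : K, hFactor (u 1) a * hFactor r b = hFactor r b * hFactor (u 1) a := fun a b =>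
    commute_hFactor (commute_hFactor hr1 a).symm b
  have i1 := hFactor_mul_inv (H.sq 1 le_rfl) hy
  have i2 := hFactor_mul_inv (H.sq 2 (by norm_num)) hx
  have i3 := hFactor_mul (H.sq 2 (by norm_num)) (x := y) (y := x) (z := s) (by rw [← hs]; ring)
  have hrk : ∀ a : K, ∀ k, 3 ≤ k → k < n → Commute (hFactor r a) (u k) := fun a k hk _ =>
    (commute_hFactor (hr3 k hk).symm a).symm
  have yb := yangBaxter hr (H.sq 2 (by norm_num)) hr2 hs
  have p1 := palProd_mul_descProd H hy (n := n) one_le_two (hFactor (u 1) y * hFactor r y)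
  have c1 := (ascProd_commute_descProd H hx hs (n := n) one_le_two).eq
  have c2 := (commute_descProd (hrk x) y).eq
  have c3 := (commute_ascProd (hrk y) x).eq
  have a1 := ascProd_mul_descProd H hx (n := n) (i := 3) (by norm_num)
  have e1 : descProd u n 1 y' = descProd u n 2 y' * hFactor (u 1) y' := descProd_succ u (by omega) _
  have e1x : descProd u n 1 x = descProd u n 2 x * hFactor (u 1) x := descProd_succ u (by omega) _
  have e2 : descProd u n 2 x' = descProd u n 3 x' * hFactor (u 2) x' := descProd_succ u (by omega) _
  have e3 : descProd u n 2 y = descProd u n 3 y * hFactor (u 2) y := descProd_succ u (by omega) _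
  have e4 : ascProd u n 2 x = hFactor (u 2) x * ascProd u n 3 x := ascProd_succ u (by omega) _
  -- The right-hand `F` first absorbs the ramp in `ȳ`, and `h_1(y)` cancels `h_1(ȳ)`. The ramps in
  -- `x` and `y` are then interchanged and meet in `h_2(s)`. The Yang–Baxter equation for `r` and `u
  -- 2` creates `h_r(s)`, and the remaining factors in `x` cancel those in `x̄`.
  calc _ = palProd u n 2 (hFactor (u 1) x * hFactor r x) x *
        (palProd u n 2 (hFactor (u 1) y * hFactor r y) y * descProd u n 2 y') *
        hFactor (u 1) y' * descProd u n 2 x' := by rw [e1]; simp only [mul_assoc]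
    _ = palProd u n 2 (hFactor (u 1) x * hFactor r x) x * descProd u n 2 y * hFactor r y *
        (hFactor (u 1) y * hFactor (u 1) y') * descProd u n 2 x' := by
        rw [p1, cr y y]; simp only [mul_assoc]
    _ = descProd u n 1 x * hFactor r x * (ascProd u n 2 x * descProd u n 2 y) * hFactor r y *
        descProd u n 2 x' := by
        rw [i1, palProd, e1x]; simp only [mul_assoc, one_mul]
    _ = descProd u n 1 x * (hFactor r x * descProd u n 3 y) * (hFactor (u 2) y * hFactor (u 2) x) *
        (ascProd u n 3 x * hFactor r y) * descProd u n 2 x' := by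
        rw [c1, e3, e4]; simp only [mul_assoc]
    _ = descProd u n 1 x * descProd u n 3 y * (hFactor r x * hFactor (u 2) s * hFactor r y) *
        (ascProd u n 3 x * descProd u n 3 x') * hFactor (u 2) x' := by
        rw [c2, ← c3, i3, e2]; simp only [mul_assoc]
    _ = descProd u n 1 x * (descProd u n 3 y * hFactor (u 2) y) * hFactor r s *
        (hFactor (u 2) x * hFactor (u 2) x') := by
        rw [yb, a1]; simp only [mul_assoc, one_mul]
    _ = _ := by rw [i2, e3, mul_one]

end YangBaxter

/-! ### The generating function at a localization point -/

section Braid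

variable {B K : Type*} [CommRing K] {M : CoxeterMatrix B} (β : K)

theorem uGen_commute {i j : B} (h : M i j = 2) : Commute (uGen M β i) (uGen M β j) := by
  have := uGen_braid (M := M) β i j
  rw [CoxeterSystem.braidWord, CoxeterSystem.braidWord, M.symmetric j i, h] at this
  simpa [CoxeterSystem.alternatingWord, Commute, SemiconjBy] using this

theorem uGen_braid_three {i j : B} (h : M i j = 3) :
    uGen M β i * uGen M β j * uGen M β i = uGen M β j * uGen M β i * uGen M β j := by
  -- `alternatingWord` ends in its second index, so a word of odd length also begins with it; hence
  -- the swapped arguments.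
  have := uGen_braid (M := M) β j i
  rw [CoxeterSystem.braidWord, CoxeterSystem.braidWord, M.symmetric j i, h] at this
  simpa [CoxeterSystem.alternatingWord, mul_assoc] using this

theorem uGen_braid_four {i j : B} (h : M i j = 4) :
    uGen M β i * uGen M β j * uGen M β i * uGen M β j =
      uGen M β j * uGen M β i * uGen M β j * uGen M β i := by
  have := uGen_braid (M := M) β i j
  rw [CoxeterSystem.braidWord, CoxeterSystem.braidWord, M.symmetric j i, h] at this
  simpa [CoxeterSystem.alternatingWord, mul_assoc] using this

end Braid

/-! ### The factors `F_n` over `R^{b, b̄}` and the recursion for the localized generating function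
-/

section Localized

variable (X : CartanType)

/-- The generator `u_k` for `k ≥ 1`, with coefficients in `R^{b, b̄}`. -/
noncomputable def uPos (k : ℕ) : IdCoxeter (coxMatrix X) Rb (beta Rb) :=
  uGen (coxMatrix X) (beta Rb) (nodePos X k)

theorem uPos_of_ne_zero (i : Node X) (h : i.1 ≠ 0) :
    uPos X i.1 = uGen (coxMatrix X) (beta Rb) i := by
  rw [uPos]
  congr 1
  exact Subtype.ext (by simp only [nodePos]; omega)

theorem coxMatrix_nodePos {k l : ℕ} (hk : 1 ≤ k) (hl : 1 ≤ l) :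
    coxMatrix X (nodePos X k) (nodePos X l) = coxeterEntry X k l := by
  rw [coxMatrix_apply]
  simp [nodePos, hk, hl]

/-- The relations are only needed for indices at least `1`; `uPos X 0` is the default value `uPos X
1`, and is not the special generator `uZero`. -/
theorem typeARel_uPos : TypeARel (beta Rb) (uPos X) where
  sq k _ := uGen_sq _ _
  braid k hk := by
    apply uGen_braid_three
    rw [coxMatrix_nodePos X hk (by omega), coxeterEntry]
    grind
  comm k l hk hl := by
    apply uGen_commute
    rw [coxMatrix_nodePos X hk (by omega), coxeterEntry]
    grind

theorem hProd_wordA (n i : ℕ) (y : Rb) :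
    hProd (coxMatrix X) (beta Rb) (wordA X n i y) = descProd (uPos X) n i y := by
  simp [hProd, wordA, descProd, hFactor, Function.comp_def, uPos]

theorem hProd_wordA' (n i : ℕ) (y : Rb) :
    hProd (coxMatrix X) (beta Rb) (wordA' X n i y) = ascProd (uPos X) n i y := by
  simp [hProd, wordA', ascProd, hFactor, Function.comp_def, uPos]

theorem hProd_flatMap {B J : Type*} (M : CoxeterMatrix B) {K : Type*} [CommRing K] (β : K)
    (l : List J) (f : J → List (B × K)) :
    hProd M β (l.flatMap f) = (l.map fun j => hProd M β (f j)).prod := by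
  induction l with
  | nil => simp [hProd]
  | cons j l ih => rw [List.flatMap_cons, hProd_append, ih, List.map_cons, List.prod_cons]

theorem bvar_add_neg (k : ℤ) : bvar k + bvar (-k) + beta Rb * bvar k * bvar (-k) = 0 :=
  bvar_oplus_neg k

theorem bvar_neg_add (k : ℤ) : bvar (-k) + bvar k + beta Rb * bvar (-k) * bvar k = 0 := by
  rw [← bvar_add_neg k]; ring

/-- The product `F_n(y)`. -/
noncomputable def fProd (n : ℕ) (y : Rb) : IdCoxeter (coxMatrix X) Rb (beta Rb) :=
  hProd (coxMatrix X) (beta Rb) (wordF X n y)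

theorem fProd_zero (n : ℕ) : fProd X n 0 = 1 := by
  rw [fProd, hProd_zero]
  intro p hp
  rw [← wordF_map (fun _ : Rb => (0 : Rb)) X n 0, List.mem_map] at hp
  obtain ⟨q, _, rfl⟩ := hp
  rfl

/-- The generator `u_0`, or `u_{1̂}` in type `D`. -/
noncomputable def uZero (hX : X ≠ .A) : IdCoxeter (coxMatrix X) Rb (beta Rb) :=
  uGen (coxMatrix X) (beta Rb) ⟨0, fun h => absurd h hX⟩

theorem uZero_sq (hX : X ≠ .A) : uZero X hX * uZero X hX = beta Rb • uZero X hX := uGen_sq _ _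

/-- In type `D` the node `1̂` is joined to the node `2`, whence the stronger bound on `k`. -/
theorem uZero_commute (hX : X ≠ .A) {k : ℕ} (hk : 2 ≤ k) (hD : X = .D → 3 ≤ k) :
    Commute (uZero X hX) (uPos X k) := by
  apply uGen_commute
  rw [coxMatrix_apply, coxeterEntry]
  simp only [nodePos]
  grind

theorem uZero_braid_four (hX : X ≠ .A) (hD : X ≠ .D) :
    uZero X hX * uPos X 1 * uZero X hX * uPos X 1 =
      uPos X 1 * uZero X hX * uPos X 1 * uZero X hX := by
  apply uGen_braid_four
  rw [coxMatrix_apply, coxeterEntry]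
  simp [nodePos, hD]

theorem uZero_commute_one : Commute (uZero .D (by simp)) (uPos .D 1) := by
  apply uGen_commute
  rw [coxMatrix_apply, coxeterEntry]
  simp [nodePos]

theorem uZero_braid_two : uZero .D (by simp) * uPos .D 2 * uZero .D (by simp) =
    uPos .D 2 * uZero .D (by simp) * uPos .D 2 := by
  apply uGen_braid_three
  rw [coxMatrix_apply, coxeterEntry]
  simp [nodePos]

theorem fProd_A (n : ℕ) (y : Rb) : fProd .A n y = 1 := by simp [fProd, wordF, hProd]

theorem fProd_B (n : ℕ) (y : Rb) :
    fProd .B n y = palProd (uPos .B) n 1 (hFactor (uZero .B (by simp)) y) y := by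
  rw [fProd, wordF, hProd_append, hProd_append, hProd_wordA, hProd_wordA', palProd]
  simp [hProd, hFactor, uZero]

theorem fProd_C (n : ℕ) (y : Rb) :
    fProd .C n y = palProd (uPos .C) n 1
      (hFactor (uZero .C (by simp)) y * hFactor (uZero .C (by simp)) y) y := by
  rw [fProd, wordF, hProd_append, hProd_append, hProd_wordA, hProd_wordA', palProd]
  simp [hProd, hFactor, uZero]

theorem fProd_D {n : ℕ} (hn : 2 ≤ n) (y : Rb) :
    fProd .D n y = palProd (uPos .D) n 2
      (hFactor (uPos .D 1) y * hFactor (uZero .D (by simp)) y) y := by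
  rw [fProd, wordF, if_neg (by omega), hProd_append, hProd_append, hProd_wordA, hProd_wordA',
    palProd]
  simp [hProd, hFactor, uZero, uPos]

/-- The products `F_n(b_k)` and `F_n(b_l)` commute. -/
theorem fProd_commute {n : ℕ} (hn : 3 ≤ n) (k l : ℤ) :
    Commute (fProd X n (bvar k)) (fProd X n (bvar l)) := by
  have hk := bvar_add_neg k
  have hl := bvar_add_neg l
  -- The witness is `b_l ⊖ b_k`.
  obtain ⟨t, ht⟩ : ∃ t, bvar k + t + beta Rb * bvar k * t = bvar l :=
    ⟨bvar l + bvar (-k) + beta Rb * bvar l * bvar (-k), by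
      linear_combination (1 + beta Rb * bvar l) * hk⟩
  have cc : ∀ (X : CartanType) (hX : X ≠ .A) (y : Rb) (k : ℕ), 2 ≤ k → (X = .D → 3 ≤ k) →
      Commute (hFactor (uZero X hX) y) (uPos X k) := fun X hX y k h1 h2 =>
    (commute_hFactor (uZero_commute X hX h1 h2).symm y).symm
  cases X with
  | A => rw [fProd_A, fProd_A]
  | B =>
    rw [fProd_B, fProd_B]
    exact palProd_commute (typeARel_uPos .B) hk hl ht rfl le_rfl (by omega)
      (fun k h => cc _ _ _ _ h (by simp)) (fun k h => cc _ _ _ _ h (by simp))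
      (reflection_eq (uZero_sq _ _) ((typeARel_uPos .B).sq 1 le_rfl)
        (uZero_braid_four _ _ (by simp)) ht rfl)
  | C =>
    rw [fProd_C, fProd_C]
    exact palProd_commute (typeARel_uPos .C) hk hl ht rfl le_rfl (by omega)
      (fun k h => (cc _ _ _ _ h (by simp)).mul_left (cc _ _ _ _ h (by simp)))
      (fun k h => (cc _ _ _ _ h (by simp)).mul_left (cc _ _ _ _ h (by simp)))
      (reflection_eq_sq (uZero_sq _ _) ((typeARel_uPos .C).sq 1 le_rfl)
        (uZero_braid_four _ _ (by simp)) ht rfl)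
  | D =>
    rw [fProd_D (by omega), fProd_D (by omega)]
    -- In type `D` the boundary consists of both nodes `1` and `1̂`, so the ramps start at `m = 2`,
    -- and `palProd_commute` requires `2 < n`.
    have c1 : ∀ (y : Rb) (k : ℕ), 2 < k → Commute (hFactor (uPos .D 1) y) (uPos .D k) :=
      fun y k h => (commute_hFactor ((typeARel_uPos .D).comm 1 k le_rfl h).symm y).symm
    exact palProd_commute (typeARel_uPos .D) hk hl ht rfl one_le_two (by omega)
      (fun k h => (c1 _ _ h).mul_left (cc _ _ _ _ (by omega) (fun _ => h)))
      (fun k h => (c1 _ _ h).mul_left (cc _ _ _ _ (by omega) (fun _ => h)))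
      (reflection_eq_fork ((typeARel_uPos .D).sq 1 le_rfl) (uZero_sq _ _)
        ((typeARel_uPos .D).sq 2 one_le_two) uZero_commute_one.symm
        ((typeARel_uPos .D).braid 1 le_rfl) uZero_braid_two ht rfl)

/-- Both the ramps and the boundary factor are inverted by `y ↦ ȳ`, so the product collapses from
the middle outwards. This makes sign changes tractable in `fLoc_neg`. -/
theorem fProd_mul_neg {n : ℕ} (hn : 3 ≤ n) (k : ℤ) :
    fProd X n (bvar k) * fProd X n (bvar (-k)) = 1 := by
  have hk := bvar_add_neg k
  cases X with
  | A => rw [fProd_A, fProd_A, one_mul]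
  | B =>
    rw [fProd_B, fProd_B]
    exact palProd_mul_inv (typeARel_uPos .B) hk le_rfl (hFactor_mul_inv (uZero_sq _ _) hk)
  | C =>
    rw [fProd_C, fProd_C]
    have h0 := hFactor_mul_inv (uZero_sq .C (by simp)) hk
    apply palProd_mul_inv (typeARel_uPos .C) hk le_rfl
    rw [mul_assoc, ← mul_assoc _ (hFactor _ (bvar (-k))), h0, one_mul, h0]
  | D =>
    rw [fProd_D (by omega), fProd_D (by omega)]
    have h0 := hFactor_mul_inv (uZero_sq .D (by simp)) hk
    have h1 := hFactor_mul_inv ((typeARel_uPos .D).sq 1 le_rfl) hk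
    apply palProd_mul_inv (typeARel_uPos .D) hk one_le_two
    have c : Commute (hFactor (uPos .D 1) (bvar (-k))) (hFactor (uZero .D (by simp)) (bvar (-k))) :=
      commute_hFactor (commute_hFactor uZero_commute_one _).symm _
    rw [c.eq, mul_assoc, ← mul_assoc _ (hFactor _ (bvar (-k))), h0, one_mul, h1]

/-- `F_n` at the value of the variable `x_k` at `v`, where `z = v(k)`. -/
noncomputable def fLoc (n : ℕ) (z : ℤ) : IdCoxeter (coxMatrix X) Rb (beta Rb) :=
  fProd X n (if z < 0 then bvar z else 0)

/-- With the convention `b_0 = 0` the case distinction becomes a single value `b_k`, so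
`fProd_commute` applies to all localized factors. -/
theorem fLoc_eq (n : ℕ) (z : ℤ) : fLoc X n z = fProd X n (bvar (min z 0)) := by
  rw [fLoc]
  split_ifs with h
  · rw [min_eq_left h.le]
  · rw [min_eq_right (by omega), bvar_zero]

theorem fLoc_commute {n : ℕ} (hn : 3 ≤ n) (y z : ℤ) : Commute (fLoc X n y) (fLoc X n z) := by
  rw [fLoc_eq, fLoc_eq]
  exact fProd_commute X hn _ _

/-- At most one of `z`, `-z` gives a nontrivial factor. If `z < 0`, the extra factor cancels the one
already present; if `z > 0`, it is the new one. -/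
theorem fLoc_neg {n : ℕ} (hn : 3 ≤ n) (z : ℤ) :
    fLoc X n (-z) = fLoc X n z * fProd X n (bvar (-z)) := by
  rcases lt_trichotomy z 0 with h | rfl | h
  · rw [fLoc, fLoc, if_neg (by omega), if_pos h, fProd_mul_neg X hn, fProd_zero]
  · simp [fLoc, bvar_zero, fProd_zero]
  · rw [fLoc, fLoc, if_pos (by omega), if_neg (by omega), fProd_zero, one_mul]

/-- The value of the generating function `G_n^X(a, b; x)` at the localization point `σ`. -/
noncomputable def genLoc (n : ℕ) (σ : Equiv.Perm ℤ) : IdCoxeter (coxMatrix X) Rb (beta Rb) :=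
  hProd (coxMatrix X) (beta Rb) (wordG X n (fun k => bvar (-σ k)) (fun k => bvar k)
    (fun k => if σ k < 0 then bvar (σ k) else 0))

/-- The last product runs up to `k = n`, one more than in `wordGA`; the extra factor is an empty
product. Both index ranges then split in the same way at `i, i + 1`, also for `i = n - 1`. -/
theorem genLoc_eq {n : ℕ} (hn : 1 ≤ n) (σ : Equiv.Perm ℤ) :
    genLoc X n σ = hProd (coxMatrix X) (beta Rb) (wordGA X n (fun k => bvar k)).reverse *
      ((List.Ico 1 (n + 1)).map fun k : ℕ => fLoc X n (σ k)).prod *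
      ((List.Ico 1 (n + 1)).map fun k : ℕ => descProd (uPos X) n k (bvar (-σ k))).prod := by
  rw [genLoc, wordG, hProd_append, hProd_append, wordGA, wordGA, hProd_flatMap, hProd_flatMap]
  congr 1
  simp only [hProd_wordA]
  rw [List.Ico.succ_top hn, List.map_append, List.prod_append]
  simp [descProd_of_le]

/-- The base of the recursion: no `x_k` survives at the identity, and `a = b̄` makes the two outer
factors inverse to each other. -/
theorem genLoc_one {n : ℕ} : genLoc X n 1 = 1 := by
  rw [genLoc, wordG, hProd_append, hProd_append, hProd_flatMap]
  have h := (wordGA_reverse_inverse X n (fun k : ℕ => bvar k) (fun k : ℕ => bvar (-k))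
    (fun k => bvar_oplus_neg k)).1
  have h2 : ((List.Ico 1 (n + 1)).map fun k : ℕ => hProd (coxMatrix X) (beta Rb)
      (wordF X n (if (1 : Equiv.Perm ℤ) k < 0 then bvar ((1 : Equiv.Perm ℤ) k) else 0))).prod
      = 1 := by
    apply List.prod_eq_one
    intro z hz
    obtain ⟨k, _, rfl⟩ := List.mem_map.mp hz
    rw [if_neg (by simp)]
    exact fProd_zero X n
  rw [h2, mul_one]
  simpa using h

theorem Ico_split {n i : ℕ} (hi : 1 ≤ i) (hn : i < n) : List.Ico 1 (n + 1) =
    List.Ico 1 i ++ (i :: (i + 1) :: List.Ico (i + 2) (n + 1)) := by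
  rw [← List.Ico.append_consecutive hi (show i ≤ n + 1 by omega),
    List.Ico.eq_cons (show i < n + 1 by omega),
    List.Ico.eq_cons (show i + 1 < n + 1 by omega)]

/-- The product of the `F`'s is unchanged because they commute. In the product of the `A`'s only the
factors at `i` and `i + 1` exchange arguments, which the exchange relation compensates by `h_i(t)`.
That factor commutes with the later `A_k`, as these only involve `u_l` with `l ≥ i + 2`. -/
theorem genLoc_mul_pos {n : ℕ} (hn : 3 ≤ n) (σ : Equiv.Perm ℤ) {i : ℕ} (hi : 1 ≤ i)
    (hin : i < n) {t : Rb} (ht : bvar (-σ i) + t + beta Rb * bvar (-σ i) * t = bvar (-σ (i + 1))) :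
    genLoc X n (σ * simplePermAux X i) = genLoc X n σ * hFactor (uPos X i) t := by
  have hs : ∀ k : ℕ, simplePermAux X i (k : ℤ) =
      if k = i then (i : ℤ) + 1 else if k = i + 1 then (i : ℤ) else k := by
    intro k
    rw [simplePermAux_apply]
    grind
  have e0 : ∀ {R : Type} (f : ℕ → ℤ → R) (k : ℕ), k ≠ i → k ≠ i + 1 →
      f k ((σ * simplePermAux X i) k) = f k (σ k) := by
    intro R f k h1 h2
    rw [Equiv.Perm.mul_apply, hs, if_neg h1, if_neg h2]
  have m0 : ∀ {R : Type} (f : ℕ → ℤ → R), ((List.Ico 1 i).map fun k : ℕ =>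
      f k ((σ * simplePermAux X i) k)) = (List.Ico 1 i).map fun k : ℕ => f k (σ k) := by
    intro R f
    apply List.map_congr_left
    intro k hk
    rw [List.Ico.mem] at hk
    exact e0 f k (by omega) (by omega)
  have m1 : ∀ {R : Type} (f : ℕ → ℤ → R), ((List.Ico (i + 2) (n + 1)).map fun k : ℕ =>
      f k ((σ * simplePermAux X i) k)) =
      (List.Ico (i + 2) (n + 1)).map fun k : ℕ => f k (σ k) := by
    intro R f
    apply List.map_congr_left
    intro k hk
    rw [List.Ico.mem] at hk
    exact e0 f k (by omega) (by omega)
  have h1 : (σ * simplePermAux X i) (i : ℤ) = σ ((i + 1 : ℕ) : ℤ) := by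
    rw [Equiv.Perm.mul_apply, hs]; simp
  have h2 : (σ * simplePermAux X i) ((i + 1 : ℕ) : ℤ) = σ i := by
    rw [Equiv.Perm.mul_apply, hs]; simp
  rw [genLoc_eq X (by omega), genLoc_eq X (by omega), Ico_split hi hin]
  simp only [List.map_append, List.map_cons, List.prod_append, List.prod_cons]
  rw [m0 (fun _ z => fLoc X n z), m1 (fun _ z => fLoc X n z),
    m0 (fun k z => descProd (uPos X) n k (bvar (-z))),
    m1 (fun k z => descProd (uPos X) n k (bvar (-z))), h1, h2]
  have c := (fLoc_commute X hn (σ ((i + 1 : ℕ) : ℤ)) (σ i)).eq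
  have ex := descProd_exchange (typeARel_uPos X) (bvar_neg_add (σ i)) ht hi hin
  have ct : Commute (hFactor (uPos X i) t) ((List.Ico (i + 2) (n + 1)).map fun k : ℕ =>
      descProd (uPos X) n k (bvar (-σ k))).prod := by
    apply Commute.list_prod_right
    intro z hz
    obtain ⟨k, hk, rfl⟩ := List.mem_map.mp hz
    rw [List.Ico.mem] at hk
    exact commute_descProd (fun l hl _ =>
      (commute_hFactor ((typeARel_uPos X).comm i l hi (by omega)).symm t).symm) _
  have ex' : ((i + 1 : ℕ) : ℤ) = (i : ℤ) + 1 := by push_cast; rfl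
  rw [ex'] at c ⊢
  rw [← mul_assoc (fLoc X n (σ (i + 1))), c]
  simp only [mul_assoc]
  rw [← ct.eq, ← mul_assoc (descProd _ _ _ _) (descProd _ _ _ _), ← ex]
  simp only [mul_assoc]

theorem Ico_cons {n : ℕ} (hn : 1 ≤ n) : List.Ico 1 (n + 1) = 1 :: List.Ico 2 (n + 1) :=
  List.Ico.eq_cons (by omega)

/-- The case `i = 0` in types `B` and `C`; here `Z = h_0` or `Z = h_0 ^ 2`. -/
theorem genLoc_mul_zero {n : ℕ} (hn : 3 ≤ n) {σ : Equiv.Perm ℤ} (hσ : σ ∈ SignedPerm)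
    (hD : X ≠ .D) {Z : IdCoxeter (coxMatrix X) Rb (beta Rb)}
    (hF : fProd X n (bvar (-σ 1)) = palProd (uPos X) n 1 Z (bvar (-σ 1)))
    (hZ : ∀ k, 2 ≤ k → Commute Z (uPos X k)) :
    genLoc X n (σ * simplePermAux X 0) = genLoc X n σ * Z := by
  have m1 : ∀ {R : Type} (f : ℕ → ℤ → R), ((List.Ico 2 (n + 1)).map fun k : ℕ =>
      f k ((σ * simplePermAux X 0) k)) = (List.Ico 2 (n + 1)).map fun k : ℕ => f k (σ k) := by
    intro R f
    apply List.map_congr_left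
    intro k hk
    rw [List.Ico.mem] at hk
    rw [Equiv.Perm.mul_apply, simplePermAux_apply]
    simp [hD, show (k : ℤ) ≠ 1 by omega, show (k : ℤ) ≠ -1 by omega]
  have h1 : (σ * simplePermAux X 0) ((1 : ℕ) : ℤ) = -σ 1 := by
    rw [Equiv.Perm.mul_apply, simplePermAux_apply, ← hσ]
    simp [hD]
  rw [genLoc_eq X (by omega), genLoc_eq X (by omega), Ico_cons (by omega)]
  simp only [List.map_cons, List.prod_cons]
  rw [m1 (fun _ z => fLoc X n z), m1 (fun k z => descProd (uPos X) n k (bvar (-z))), h1, neg_neg,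
    fLoc_neg X hn, Nat.cast_one]
  -- The inserted `F(b_{-σ(1)})` is carried past the other `F`'s until it meets `A_1(b_{σ(1)})`. The
  -- result is `A_1(b_{-σ(1)}) Z`, and `Z` passes the `A_k` with `k ≥ 2`.
  have ex := palProd_mul_descProd (typeARel_uPos X) (n := n) (m := 1) (bvar_neg_add (σ 1)) le_rfl Z
  rw [← hF] at ex
  have ct : Commute Z ((List.Ico 2 (n + 1)).map fun k : ℕ =>
      descProd (uPos X) n k (bvar (-σ k))).prod := by
    apply Commute.list_prod_right
    intro z hz
    obtain ⟨k, hk, rfl⟩ := List.mem_map.mp hz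
    rw [List.Ico.mem] at hk
    exact commute_descProd (fun l hl _ => hZ l (by omega)) _
  have cF : Commute (fProd X n (bvar (-σ 1))) ((List.Ico 2 (n + 1)).map fun k : ℕ =>
      fLoc X n (σ k)).prod := by
    apply Commute.list_prod_right
    intro z hz
    obtain ⟨k, hk, rfl⟩ := List.mem_map.mp hz
    rw [fLoc_eq]
    exact fProd_commute X hn _ _
  simp only [mul_assoc]
  rw [← ct.eq, ← mul_assoc (fProd _ _ _), cF.eq, mul_assoc, ← mul_assoc (fProd _ _ _), ex]
  simp only [mul_assoc]

/-- The regrouping that ends `genLoc_mul_hat`: `p, q` are the inserted `F`'s, `F` and `D` the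
untouched products, `d, e` and `d', e'` the first two `A`'s after and before the reflection. -/
theorem mul_rearrange {G : Type*} [Monoid G] {c f g p q F d e D d' e' h : G}
    (h1 : p * q * F = F * (p * q)) (h2 : p * q * (d * e) = d' * e' * h) (h3 : h * D = D * h) :
    c * (f * (g * (p * (q * (F * (d * (e * D))))))) =
      c * (f * (g * (F * (d' * (e' * (D * h)))))) := by
  calc _ = c * (f * (g * (p * q * F * (d * (e * D))))) := by simp only [mul_assoc]
    _ = c * (f * (g * (F * (p * q * (d * e) * D)))) := by rw [h1]; simp only [mul_assoc]
    _ = _ := by rw [h2, mul_assoc, h3]; simp only [mul_assoc]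

/-- The reflection exchanges `σ(1)` and `σ(2)` and changes both signs. This inserts two factors `F`,
which together are absorbed by `A_1 A_2` according to `palProd_fork`. -/
theorem genLoc_mul_hat {n : ℕ} (hn : 3 ≤ n) {σ : Equiv.Perm ℤ} (hσ : σ ∈ SignedPerm) {s : Rb}
    (hs : bvar (-σ 1) + bvar (-σ 2) + beta Rb * bvar (-σ 1) * bvar (-σ 2) = s) :
    genLoc .D n (σ * simplePermAux .D 0) = genLoc .D n σ * hFactor (uZero .D (by simp)) s := by
  have m1 : ∀ {R : Type} (f : ℕ → ℤ → R), ((List.Ico 3 (n + 1)).map fun k : ℕ =>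
      f k ((σ * simplePermAux .D 0) k)) = (List.Ico 3 (n + 1)).map fun k : ℕ => f k (σ k) := by
    intro R f
    apply List.map_congr_left
    intro k hk
    rw [List.Ico.mem] at hk
    rw [Equiv.Perm.mul_apply, simplePermAux_apply]
    simp [show (k : ℤ) ≠ 1 by omega, show (k : ℤ) ≠ -1 by omega, show (k : ℤ) ≠ 2 by omega,
      show (k : ℤ) ≠ -2 by omega]
  have h1 : (σ * simplePermAux .D 0) ((1 : ℕ) : ℤ) = -σ 2 := by
    rw [Equiv.Perm.mul_apply, simplePermAux_apply, ← hσ]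
    simp
  have h2 : (σ * simplePermAux .D 0) ((2 : ℕ) : ℤ) = -σ 1 := by
    rw [Equiv.Perm.mul_apply, simplePermAux_apply, ← hσ]
    simp
  have hI : List.Ico 2 (n + 1) = 2 :: List.Ico 3 (n + 1) := List.Ico.eq_cons (by omega)
  rw [genLoc_eq .D (by omega), genLoc_eq .D (by omega), Ico_cons (by omega), hI]
  simp only [List.map_cons, List.prod_cons]
  rw [m1 (fun _ z => fLoc .D n z), m1 (fun k z => descProd (uPos .D) n k (bvar (-z))), h1, h2,
    neg_neg, neg_neg, fLoc_neg .D hn, fLoc_neg .D hn, Nat.cast_one, Nat.cast_two]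
  have ex := palProd_fork (typeARel_uPos .D) (uZero_sq .D (by simp)) uZero_commute_one
    uZero_braid_two (fun k hk => uZero_commute .D (by simp) (by omega) (fun _ => hk))
    (bvar_neg_add (σ 1)) (bvar_neg_add (σ 2)) hs (n := n) (by omega)
  rw [← fProd_D (by omega), ← fProd_D (by omega)] at ex
  have ct : Commute (hFactor (uZero .D (by simp)) s) ((List.Ico 3 (n + 1)).map fun k : ℕ =>
      descProd (uPos .D) n k (bvar (-σ k))).prod := by
    apply Commute.list_prod_right
    intro z hz
    obtain ⟨k, hk, rfl⟩ := List.mem_map.mp hz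
    rw [List.Ico.mem] at hk
    exact commute_descProd (fun l hl _ => (commute_hFactor
      (uZero_commute .D (by simp) (by omega) (fun _ => by omega)).symm s).symm) _
  have cF : Commute (fProd .D n (bvar (-σ 1)) * fProd .D n (bvar (-σ 2)))
      ((List.Ico 3 (n + 1)).map fun k : ℕ => fLoc .D n (σ k)).prod := by
    apply Commute.list_prod_right
    intro z hz
    obtain ⟨k, hk, rfl⟩ := List.mem_map.mp hz
    rw [fLoc_eq]
    exact (fProd_commute .D hn _ _).mul_left (fProd_commute .D hn _ _)
  -- All factors here are values of `F_n` and commute; the order is restored and the two inserted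
  -- ones are collected on the right.
  have swap : fLoc .D n (σ 2) * fProd .D n (bvar (-σ 2)) *
      (fLoc .D n (σ 1) * fProd .D n (bvar (-σ 1))) = fLoc .D n (σ 1) * fLoc .D n (σ 2) *
      (fProd .D n (bvar (-σ 1)) * fProd .D n (bvar (-σ 2))) := by
    have c1 : Commute (fLoc .D n (σ 2)) (fLoc .D n (σ 1) * fProd .D n (bvar (-σ 1))) := by
      rw [fLoc_eq, fLoc_eq]
      exact (fProd_commute .D hn _ _).mul_right (fProd_commute .D hn _ _)
    have c2 : Commute (fProd .D n (bvar (-σ 2)))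
        (fLoc .D n (σ 1) * fProd .D n (bvar (-σ 1))) := by
      rw [fLoc_eq]
      exact (fProd_commute .D hn _ _).mul_right (fProd_commute .D hn _ _)
    have c3 : Commute (fProd .D n (bvar (-σ 1))) (fLoc .D n (σ 2)) := by
      rw [fLoc_eq]
      exact fProd_commute .D hn _ _
    rw [(c1.mul_left c2).eq, mul_assoc, ← mul_assoc _ (fLoc .D n (σ 2)), c3.eq]
    simp only [mul_assoc]
  rw [← mul_assoc (_ * _) (_ * _), swap]
  simp only [mul_assoc]
  exact mul_rearrange cF.eq ex ct.eq

/-- Right multiplication by a simple reflection multiplies the localized generating function by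
`h_i(v(α_i))`. -/
theorem genLoc_mul_simple {n : ℕ} (hn : 3 ≤ n) (v : Weyl X) {i : Node X} (hi : i.1 < n) :
    genLoc X n (signedPerm X (v * (weylSystem X).simple i) : Equiv.Perm ℤ) =
      genLoc X n (signedPerm X v : Equiv.Perm ℤ) *
        hFactor (uGen (coxMatrix X) (beta Rb) i) (v • alpha X i) := by
  set σ : Equiv.Perm ℤ := (signedPerm X v).1
  have hσ : σ ∈ SignedPerm := (signedPerm X v).2
  have hneg : ∀ k, σ (-k) = -σ k := hσ
  have hv : ∀ k, v • bvar k = bvar (σ k) := weyl_smul_bvar X v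
  have hop : ∀ x y : Rb, v • oplus x y = oplus (v • x) (v • y) := by
    intro x y
    simp only [oplus, smul_add, smul_mul', beta, weyl_smul_algebraMap]
  have e : ((signedPerm X (v * (weylSystem X).simple i) : SignedPerm) : Equiv.Perm ℤ) =
      σ * simplePermAux X i.1 := by
    rw [map_mul, signedPerm_simple]
    rfl
  rw [e]
  by_cases h0 : i.1 = 0
  · obtain ⟨i, hA⟩ := i
    simp only at h0 hi
    subst h0
    cases X with
    | A => exact absurd rfl (hA rfl)
    | B =>
      have ha : v • alpha .B ⟨0, hA⟩ = bvar (-σ 1) := by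
        simp only [alpha, if_pos, hv, hneg]
      rw [ha]
      exact genLoc_mul_zero .B hn hσ (by simp) (fProd_B n _) fun k hk =>
        (commute_hFactor (uZero_commute .B (by simp) hk (by simp)).symm _).symm
    | C =>
      have ha : v • alpha .C ⟨0, hA⟩ = oplus (bvar (-σ 1)) (bvar (-σ 1)) := by
        simp only [alpha, if_pos, hv, hneg, hop]
      have c : ∀ k, 2 ≤ k → Commute (hFactor (uZero .C (by simp)) (bvar (-σ 1))) (uPos .C k) :=
        fun k hk => (commute_hFactor (uZero_commute .C (by simp) hk (by simp)).symm _).symm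
      -- In type `C` the root is `b_{-σ(1)} ⊕ b_{-σ(1)}`, so its factor is the square
      -- `h_0(b_{-σ(1)}) ^ 2` in the middle of `F_n^C`.
      rw [ha, ← hFactor_mul (uGen_sq (beta Rb) _) (x := bvar (-σ 1)) (y := bvar (-σ 1))
        (z := oplus (bvar (-σ 1)) (bvar (-σ 1))) rfl]
      exact genLoc_mul_zero .C hn hσ (by simp) (fProd_C n _) fun k hk =>
        (c k hk).mul_left (c k hk)
    | D =>
      have ha : v • alpha .D ⟨0, hA⟩ = oplus (bvar (-σ 1)) (bvar (-σ 2)) := by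
        simp only [alpha, if_pos, hv, hneg, hop]
      rw [ha]
      exact genLoc_mul_hat hn hσ rfl
  · have ha : v • alpha X i = oplus (bvar (σ i.1)) (bvar (-σ (i.1 + 1))) := by
      rw [alpha.eq_def, if_neg h0, hop, hv, hv, hneg]
    rw [ha, ← uPos_of_ne_zero X i h0]
    refine genLoc_mul_pos X hn σ (by omega) hi ?_
    simp only [oplus]
    -- This is `b_{-σ(i)} ⊕ (b_{σ(i)} ⊕ b_{-σ(i+1)}) = b_{-σ(i+1)}`, from `b_k ⊕ b_{-k} = 0`.
    linear_combination (1 + beta Rb * bvar (-σ (i.1 + 1))) * bvar_add_neg (σ i.1)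

end Localized

/-! ### Base change of coefficients -/

section BaseChange

variable {B W K L : Type*} [Group W] {M : CoxeterMatrix B} {cs : CoxeterSystem M W}
  [CommRing K] [CommRing L]

/-- Coefficients are compatible with ring homomorphisms. -/
theorem map_uCoeff_hProd_ringHom (hg : GoodOrders cs) (f : K →+* L) {β : K} {γ : L}
    (hf : f β = γ) (w : W) (l : List (B × K)) : f (uCoeff β hg w (hProd M β l)) =
      uCoeff γ hg w (hProd M γ (l.map fun p => (p.1, f p.2))) := by
  -- In the basis `u_w`, left multiplication by `u_i` has the structure constants `0`, `1` and `β`,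
  -- all respected by `f`.
  have hL : ∀ (i : B) (x : W →₀ K), Finsupp.mapRange f (map_zero f) (leftOp cs β i x) =
      leftOp cs γ i (Finsupp.mapRange f (map_zero f) x) := by
    intro i x
    induction x using Finsupp.induction_linear with
    | zero => simp
    | add x y hx hy =>
      rw [map_add, Finsupp.mapRange_add (map_add f), hx, hy, Finsupp.mapRange_add (map_add f),
        map_add]
    | single w c =>
      by_cases h : cs.length w < cs.length (cs.simple i * w)
      · rw [leftOp_up cs β h, Finsupp.mapRange_single, Finsupp.mapRange_single, leftOp_up cs γ h]
      · rw [leftOp_down cs β h, Finsupp.mapRange_single, Finsupp.mapRange_single,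
          leftOp_down cs γ h, map_mul, hf]
  have hl : Finsupp.mapRange f (map_zero f) ((uBasis β hg).repr (hProd M β l)) =
      (uBasis γ hg).repr (hProd M γ (l.map fun p => (p.1, f p.2))) := by
    simp only [repr_eq_regRep]
    induction l with
    | nil => simp [hProd]
    | cons p l ih =>
      have e1 : regRep β hg (hProd M β (p :: l)) (Finsupp.single 1 1) =
          regRep β hg (hProd M β l) (Finsupp.single 1 1) +
            p.2 • leftOp cs β p.1 (regRep β hg (hProd M β l) (Finsupp.single 1 1)) := by
        simp [hProd, regRep, add_mul]
      have e2 : ∀ (p : B × L) (l : List (B × L)),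
          regRep γ hg (hProd M γ (p :: l)) (Finsupp.single 1 1) =
          regRep γ hg (hProd M γ l) (Finsupp.single 1 1) +
            p.2 • leftOp cs γ p.1 (regRep γ hg (hProd M γ l) (Finsupp.single 1 1)) := by
        intro p l
        simp [hProd, regRep, add_mul]
      rw [List.map_cons, e1, e2, ← ih, Finsupp.mapRange_add (map_add f), ← hL,
        Finsupp.mapRange_smul' p.2 (f p.2) _ (by intro x; simp)]
  have := DFunLike.congr_fun hl w
  simpa [uCoeff] using this

theorem uCoeff_smul (hg : GoodOrders cs) (β : K) (w : W) (a : K) (x : IdCoxeter M K β) :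
    uCoeff β hg w (a • x) = a * uCoeff β hg w x := by
  simp [uCoeff]

theorem uCoeff_sum (hg : GoodOrders cs) (β : K) (w : W) {J : Type*} (s : Finset J)
    (f : J → IdCoxeter M K β) :
    uCoeff β hg w (∑ j ∈ s, f j) = ∑ j ∈ s, uCoeff β hg w (f j) := by
  simp only [uCoeff, map_sum, Finsupp.finsetSum_apply]

theorem uCoeff_uElt [DecidableEq W] (hg : GoodOrders cs) (β : K) (w v : W) :
    uCoeff β hg w (uElt cs β v) = if v = w then 1 else 0 := by
  rw [uCoeff, ← uBasis_apply β hg, Module.Basis.repr_self, Finsupp.single_apply]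

/-! ### Demazure products of subwords -/

variable (cs)

open Classical in
/-- The Demazure product of a word. -/
noncomputable def demazure : List B → W
  | [] => 1
  | i :: ω => if cs.length (demazure ω) < cs.length (cs.simple i * demazure ω) then
      cs.simple i * demazure ω else demazure ω

/-- Guarantees that the natural subtraction in the exponent of `β` is not truncated. -/
theorem length_demazure_le (ω : List B) : cs.length (demazure cs ω) ≤ ω.length := by
  induction ω with
  | nil => simp [demazure]
  | cons i ω ih =>
    rw [demazure, List.length_cons]
    have := cs.length_simple_mul (demazure cs ω) i
    split_ifs <;> omega

/-- Reading the word from the right, a letter either lengthens the current element or is absorbed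
with a factor `β`; the exponent counts the absorbed letters. -/
theorem uGen_prod_eq {cs : CoxeterSystem M W} (hg : GoodOrders cs) (β : K) (ω : List B) :
    (ω.map (uGen M β)).prod =
      β ^ (ω.length - cs.length (demazure cs ω)) • uElt cs β (demazure cs ω) := by
  induction ω with
  | nil => simp [demazure, uElt_one β hg]
  | cons i ω ih =>
    have h1 := length_demazure_le cs ω
    have h2 := cs.length_simple_mul (demazure cs ω) i
    rw [List.map_cons, List.prod_cons, ih, mul_smul_comm, demazure, List.length_cons]
    split_ifs with h
    · rw [uGen_mul_uElt_up β hg h]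
      congr 2
      omega
    · rw [uGen_mul_uElt_down β hg h, smul_smul, ← pow_succ]
      congr 2
      omega

/-- The subword selected by `c`. -/
def selected {B : Type*} : (i : List B) → (Fin i.length → Fin 2) → List B
  | [], _ => []
  | s :: i, c => if c 0 = 1 then s :: selected i (fun k => c k.succ)
      else selected i (fun k => c k.succ)

theorem length_selected {B : Type*} (i : List B) (c : Fin i.length → Fin 2) :
    (selected i c).length = weight c := by
  induction i with
  | nil => simp [selected, weight]
  | cons s i ih =>
    have e : weight c = (c 0 : ℕ) + weight (fun k : Fin i.length => c k.succ) :=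
      Fin.sum_univ_succ (fun k : Fin (i.length + 1) => ((c k : Fin 2) : ℕ))
    rw [e, ← ih, selected]
    split_ifs with h
    · rw [h, List.length_cons]; simp [add_comm]
    · have : c 0 = 0 := by omega
      rw [this]; simp

theorem prod_selected {B G : Type*} [Monoid G] (f : B → G) (i : List B)
    (c : Fin i.length → Fin 2) :
    (List.ofFn fun k => if c k = 1 then f (i.get k) else 1).prod = ((selected i c).map f).prod := by
  induction i with
  | nil => simp [selected]
  | cons s i ih =>
    have := ih (fun k => c k.succ)
    have e : (List.ofFn fun k : Fin (s :: i).length =>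
        if c k = 1 then f ((s :: i).get k) else 1).prod = (if c 0 = 1 then f s else 1) *
        (List.ofFn fun k : Fin i.length => if c k.succ = 1 then f (i.get k) else 1).prod := by
      exact (congrArg List.prod (List.ofFn_succ (n := i.length))).trans List.prod_cons
    rw [e, this, selected]
    split_ifs <;> simp

end BaseChange

/-- The product of the selected generators is a power of `β` times the basis element of the Demazure
product. Powers of `β` are nonzero in `ℤ[β]`, so comparing coefficients there forces that element to
be `w`. -/
theorem mem_subwords {X : CartanType} {i : List (Node X)} {w : Weyl X}
    {c : Fin i.length → Fin 2} :
    c ∈ subwords X i w ↔ demazure (weylSystem X) (selected i c) = w := by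
  classical
  have hg := weyl_goodOrders X
  have hlen := length_demazure_le (weylSystem X) (selected i c)
  rw [length_selected] at hlen
  rw [subwords, Finset.mem_filter, prod_selected, uGen_prod_eq hg, length_selected]
  constructor
  · rintro ⟨_, _, h⟩
    have h' := congrArg (uCoeff (beta Zbeta) hg (demazure (weylSystem X) (selected i c))) h
    rw [uCoeff_smul, uCoeff_smul, uCoeff_uElt, uCoeff_uElt, if_pos rfl] at h'
    by_contra hne
    rw [if_neg (Ne.symm hne), mul_zero, mul_one] at h'
    exact pow_ne_zero _ Polynomial.X_ne_zero h'
  · rintro rfl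
    exact ⟨Finset.mem_univ _, hlen, rfl⟩

open Classical in
theorem subwords_eq_filter (X : CartanType) (i : List (Node X)) (w : Weyl X) :
    subwords X i w =
      Finset.univ.filter fun c => demazure (weylSystem X) (selected i c) = w := by
  ext c
  rw [mem_subwords, Finset.mem_filter, and_iff_right (Finset.mem_univ c)]

/-! ### Localization along a word -/

section LocalizedWord

variable (X : CartanType)

/-- The coefficient of the smash product element `smashProd X i c`. -/
theorem smashProd_eq_single (i : List (Node X)) (c : Fin i.length → Fin 2) :
    smashProd X i c =
      SkewMonoidAlgebra.single ((weylSystem X).wordProd i) (smashEps X (smashProd X i c)) := by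
  suffices ∃ f, smashProd X i c = SkewMonoidAlgebra.single ((weylSystem X).wordProd i) f by
    obtain ⟨f, hf⟩ := this
    rw [hf, smashEps_single]
  induction i with
  | nil => exact ⟨1, rfl⟩
  | cons s i ih =>
    obtain ⟨f, hf⟩ := ih (fun k => c k.succ)
    have e : smashProd X (s :: i) c = (if c 0 = 1 then
        SkewMonoidAlgebra.single ((weylSystem X).simple s) (alpha X s)
        else SkewMonoidAlgebra.single ((weylSystem X).simple s) (1 : Rb)) *
        smashProd X i (fun k => c k.succ) :=
      (congrArg List.prod (List.ofFn_succ (n := i.length))).trans List.prod_cons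
    rw [e, hf, CoxeterSystem.wordProd_cons]
    split_ifs <;> exact ⟨_, SkewMonoidAlgebra.single_mul_single⟩

/-- `ε` is not multiplicative; by `(f ⊗ s) (g ⊗ w) = f s(g) ⊗ s w`, the first letter twists the
coefficient of the remaining ones. -/
theorem smashEps_smashProd_cons (s : Node X) (i : List (Node X))
    (c : Fin (s :: i).length → Fin 2) :
    smashEps X (smashProd X (s :: i) c) = (if c 0 = 1 then alpha X s else 1) *
      (weylSystem X).simple s • smashEps X (smashProd X i (fun k => c k.succ)) := by
  have e : smashProd X (s :: i) c = (if c 0 = 1 then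
      SkewMonoidAlgebra.single ((weylSystem X).simple s) (alpha X s)
      else SkewMonoidAlgebra.single ((weylSystem X).simple s) (1 : Rb)) *
      smashProd X i (fun k => c k.succ) :=
    (congrArg List.prod (List.ofFn_succ (n := i.length))).trans List.prod_cons
  rw [e, smashProd_eq_single X i]
  split_ifs <;> rw [SkewMonoidAlgebra.single_mul_single, smashEps_single, smashEps_single]

/-- The product of the factors `h_{i_k}(g s_{i_1} ⋯ s_{i_{k-1}} α_{i_k})`. -/
noncomputable def locProd : Weyl X → List (Node X) → IdCoxeter (coxMatrix X) Rb (beta Rb)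
  | _, [] => 1
  | g, s :: i => hFactor (uGen (coxMatrix X) (beta Rb) s) (g • alpha X s) *
      locProd (g * (weylSystem X).simple s) i

/-- The starting point `g` is arbitrary because each letter of the word shifts it in the induction.
-/
theorem genLoc_mul_wordProd {n : ℕ} (hn : 3 ≤ n) (i : List (Node X)) :
    ∀ g : Weyl X, (∀ s ∈ i, s.1 < n) →
    genLoc X n (signedPerm X (g * (weylSystem X).wordProd i) : Equiv.Perm ℤ) =
      genLoc X n (signedPerm X g : Equiv.Perm ℤ) * locProd X g i := by
  induction i with
  | nil => intro g _; simp [locProd]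
  | cons s i ih =>
    intro g h
    rw [CoxeterSystem.wordProd_cons, ← mul_assoc, ih _ fun t ht => h t (List.mem_cons_of_mem _ ht),
      genLoc_mul_simple X hn g (h s List.mem_cons_self), locProd, mul_assoc]

theorem sum_fin_two_cons {G : Type*} [AddCommMonoid G] {n : ℕ}
    (F : (Fin (n + 1) → Fin 2) → G) :
    ∑ c, F c = ∑ c : Fin n → Fin 2, (F (Fin.cons 0 c) + F (Fin.cons 1 c)) := by
  rw [← (Fin.consEquiv (fun _ : Fin (n + 1) => Fin 2)).sum_comp F,
    Fintype.sum_prod_type, Fin.sum_univ_two, ← Finset.sum_add_distrib]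
  rfl

/-- Expanding the product, the letter `s` contributes `1` for `c_k = 0` and its root times `u_s` for
`c_k = 1`. The action accumulated by the earlier letters is what the smash product stores. -/
theorem locProd_eq_sum (i : List (Node X)) : ∀ g : Weyl X, locProd X g i =
    ∑ c : Fin i.length → Fin 2, (g • smashEps X (smashProd X i c)) •
      ((selected i c).map (uGen (coxMatrix X) (beta Rb))).prod := by
  induction i with
  | nil =>
    intro g
    have e : ∀ c, smashEps X (smashProd X [] c) = 1 := fun c => smashEps_single X 1 1
    refine Eq.symm ((Fintype.sum_unique (ι := Fin 0 → Fin 2) fun c : Fin 0 → Fin 2 =>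
      (g • smashEps X (smashProd X [] c)) •
        ((selected [] c).map (uGen (coxMatrix X) (beta Rb))).prod).trans ?_)
    rw [e, smul_one, one_smul, locProd, selected, List.map_nil, List.prod_nil]
  | cons s i ih =>
    intro g
    rw [locProd, ih, Finset.mul_sum]
    refine Eq.symm ((sum_fin_two_cons (n := i.length) _).trans ?_)
    apply Finset.sum_congr rfl
    intro c _
    have e0 := smashEps_smashProd_cons X s i (Fin.cons 0 c)
    have e1 := smashEps_smashProd_cons X s i (Fin.cons 1 c)
    have s0 : selected (s :: i) (Fin.cons 0 c) = selected i c := rfl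
    have s1 : selected (s :: i) (Fin.cons 1 c) = s :: selected i c := rfl
    -- Evaluates `Fin.cons` definitionally: its head selects the coefficient and its tail is `c`.
    replace e0 : _ = 1 * (weylSystem X).simple s • smashEps X (smashProd X i c) := e0
    replace e1 : _ = alpha X s * (weylSystem X).simple s • smashEps X (smashProd X i c) := e1
    have hg : g • (alpha X s * (weylSystem X).simple s • smashEps X (smashProd X i c)) =
        g • alpha X s * (g * (weylSystem X).simple s) • smashEps X (smashProd X i c) := by
      rw [smul_mul' g (alpha X s), mul_smul]
    rw [e0, e1, s0, s1, hg, List.map_cons, List.prod_cons, one_mul, ← mul_smul g, hFactor,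
      add_mul, one_mul, smul_mul_smul_comm (g • alpha X s) (uGen (coxMatrix X) (beta Rb) s)]

/-- The substituted polynomial `𝒢_{n,w}` is a coefficient of the localized generating function. -/
theorem substAt_grothFin (n : ℕ) (w v : Weyl X) : substAt X v (grothFin X n w) =
    uCoeff (beta Rb) (weyl_goodOrders X) w
      (genLoc X n (signedPerm X v : Equiv.Perm ℤ)) := by
  have hb : (substAt X v : PolyRing →+* Rb) (beta PolyRing) = beta Rb := by
    rw [beta, IsScalarTower.algebraMap_apply Zbeta Rb PolyRing]
    exact (substAt X v).commutes _
  rw [grothFin, genFun]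
  refine (map_uCoeff_hProd_ringHom (weyl_goodOrders X) (substAt X v : PolyRing →+* Rb) hb w
    _).trans ?_
  rw [wordG_map, genLoc]
  congr 2
  -- The bound is essential: `aVar 0` and `xVar 0` coincide with the variables of index `1`. The
  -- words only use indices from `1` on.
  have hA : ∀ k : ℕ, 1 ≤ k → (substAt X v : PolyRing →+* Rb) (aVar k) =
      bvar (-(signedPerm X v : Equiv.Perm ℤ) k) := by
    intro k hk
    obtain ⟨k, rfl⟩ := Nat.exists_eq_add_of_le' hk
    simp [substAt, aVar]
  have hX : ∀ k : ℕ, 1 ≤ k → (substAt X v : PolyRing →+* Rb) (xVar k) =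
      if (signedPerm X v : Equiv.Perm ℤ) k < 0 then bvar ((signedPerm X v : Equiv.Perm ℤ) k)
        else 0 := by
    intro k hk
    obtain ⟨k, rfl⟩ := Nat.exists_eq_add_of_le' hk
    simp [substAt, xVar]
  have hB : ∀ k : ℕ, (substAt X v : PolyRing →+* Rb) (bConst k) = bvar k := fun k =>
    (substAt X v).commutes (bvar k)
  rw [wordG, wordG, wordGA, wordGA, wordGA, wordGA]
  simp only [hB]
  congr 1
  · congr 1
    rw [List.flatMap_def, List.flatMap_def]
    congr 1
    apply List.map_congr_left
    intro k hk
    rw [hX k (List.Ico.mem.mp hk).1]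
  · rw [List.flatMap_def, List.flatMap_def]
    congr 1
    apply List.map_congr_left
    intro k hk
    rw [hA k (List.Ico.mem.mp hk).1]

/-- The localization formula, for an arbitrary word. -/
theorem localization_groth_wordProd (w : Weyl X) (i : List (Node X)) :
    localization X (groth X w) ((weylSystem X).wordProd i) =
      smashEps X (∑ c ∈ subwords X i w,
        beta Rb ^ (weight c - (weylSystem X).length w) • smashProd X i c) := by
  classical
  obtain ⟨m, hm⟩ : ∃ m, ∀ s ∈ i, s.1 < m := by
    refine ⟨(i.map Subtype.val).sum + 1, fun s hs => ?_⟩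
    have := List.single_le_sum (l := i.map Subtype.val) (by simp) s.1 (List.mem_map_of_mem hs)
    omega
  -- A finite rank large enough for the commutation lemmas, for all letters of the word, and for
  -- both `w` and the point of localization; there the limit is represented by `grothFin X n w`.
  obtain ⟨n, hn3, hnm, hnw, hnv⟩ : ∃ n, 3 ≤ n ∧ m ≤ n ∧ rankOf X w ≤ n ∧
      rankOf X ((weylSystem X).wordProd i) ≤ n :=
    ⟨max (max 3 m) (max (rankOf X w) (rankOf X ((weylSystem X).wordProd i))), by omega, by omega,
      by omega, by omega⟩
  have hw := weylFin_mono X hnw (mem_weylFin_rankOf X w)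
  have hv := weylFin_mono X hnv (mem_weylFin_rankOf X ((weylSystem X).wordProd i))
  have hgen := genLoc_mul_wordProd X hn3 i 1 fun s hs => (hm s hs).trans_le hnm
  rw [one_mul, map_one, Subgroup.coe_one, genLoc_one, one_mul, locProd_eq_sum] at hgen
  rw [localization_apply X hv, groth_apply X hw, substAt_grothFin, hgen, uCoeff_sum, map_sum,
    subwords_eq_filter, Finset.sum_filter]
  apply Finset.sum_congr rfl
  intro c _
  rw [one_smul, uGen_prod_eq (weyl_goodOrders X), uCoeff_smul, uCoeff_smul, uCoeff_uElt,
    map_smul, length_selected]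
  split_ifs with h
  · rw [h, smul_eq_mul, mul_one, mul_comm]
  · simp

end LocalizedWord

/-! ### Strong exchange and the Bruhat order -/

section Bruhat

open CoxeterSystem

variable {B W : Type*} [Group W] {M : CoxeterMatrix B} (cs : CoxeterSystem M W)

open Classical in
-- A cocycle rule for the parity of inversions, read off from composing the signed conjugation
-- action of the two words on `W × ZMod 2`.
theorem count_rightInvSeq_append (ω η : List B) (t : W) :
    ((cs.rightInvSeq (ω ++ η)).count t : ZMod 2) =
      (cs.rightInvSeq η).count t +
        ((cs.rightInvSeq ω).count (cs.wordProd η * t * (cs.wordProd η)⁻¹) : ℕ) := by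
  have h := signedConj_word cs (ω ++ η) t 0
  rw [List.map_append, List.prod_append] at h
  change (ω.map (signedConj cs)).prod ((η.map (signedConj cs)).prod (t, 0)) = _ at h
  rw [signedConj_word, signedConj_word] at h
  have := congrArg Prod.snd h
  simp only [zero_add] at this
  exact this.symm

open Classical in
-- The parity depends only on the group element, so the palindromic word `η s η⁻¹` of `t` may be
-- used. The two halves contribute as they do in `η η⁻¹`, that is, evenly, and the central letter
-- adds `1`.
theorem count_rightInvSeq_self {ω : List B} {t : W} (ht : cs.IsReflection t)
    (h : cs.wordProd ω = t) : ((cs.rightInvSeq ω).count t : ZMod 2) = 1 := by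
  obtain ⟨w, i, rfl⟩ := ht
  obtain ⟨η, rfl⟩ := cs.wordProd_surjective w
  have e : cs.wordProd (η ++ ([i] ++ η.reverse)) = cs.wordProd ω := by
    rw [h, wordProd_append, wordProd_append, wordProd_singleton, wordProd_reverse, mul_assoc]
  have h0 := count_rightInvSeq_append cs η η.reverse
    (cs.wordProd η * cs.simple i * (cs.wordProd η)⁻¹)
  have h1 : cs.wordProd (η ++ η.reverse) = cs.wordProd [] := by
    rw [wordProd_append, wordProd_reverse, mul_inv_cancel, wordProd_nil]
  rw [count_rightInvSeq_congr cs h1] at h0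
  have c1 : cs.wordProd η.reverse * (cs.wordProd η * cs.simple i * (cs.wordProd η)⁻¹) *
      (cs.wordProd η.reverse)⁻¹ = cs.simple i := by
    rw [wordProd_reverse]; group
  rw [c1] at h0
  rw [← count_rightInvSeq_congr cs e, count_rightInvSeq_append, count_rightInvSeq_append, c1,
    wordProd_append, wordProd_singleton, mul_assoc (cs.simple i), mul_inv_rev,
    show cs.simple i * (cs.wordProd η.reverse *
      (cs.wordProd η * cs.simple i * (cs.wordProd η)⁻¹)) *
      ((cs.wordProd η.reverse)⁻¹ * (cs.simple i)⁻¹) = cs.simple i * (cs.wordProd η.reverse *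
      (cs.wordProd η * cs.simple i * (cs.wordProd η)⁻¹) * (cs.wordProd η.reverse)⁻¹) *
      (cs.simple i)⁻¹ by group, c1, mul_inv_cancel_right]
  simp only [rightInvSeq_nil, List.count_nil, Nat.cast_zero] at h0
  rw [add_right_comm, ← h0]
  simp

/-- Strong exchange: the right inversions of an element occur in the inversion sequence of every
word for it. -/
theorem mem_rightInvSeq_of_isRightInversion {ω : List B} {t : W}
    (h : cs.IsRightInversion (cs.wordProd ω) t) : t ∈ cs.rightInvSeq ω := by
  classical
  obtain ⟨ht, hlt⟩ := h
  by_contra hn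
  obtain ⟨η, hη, he⟩ := cs.exists_isReduced (cs.wordProd ω * t)
  obtain ⟨τ, hτ⟩ := cs.wordProd_surjective t
  have e : cs.wordProd (ω ++ τ) = cs.wordProd η := by rw [wordProd_append, hτ, he]
  -- If `t` does not occur for `ω`, appending a word of `t` makes its parity odd. Then `t` is an
  -- inversion of a reduced word of `w t`, where `w` is the product of `ω`, so `ℓ(w) < ℓ(w t)`, a
  -- contradiction.
  have hc := count_rightInvSeq_congr cs e t
  rw [count_rightInvSeq_append, count_rightInvSeq_self cs ht hτ, hτ, mul_inv_cancel_right,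
    List.count_eq_zero_of_not_mem hn, Nat.cast_zero, add_zero] at hc
  have hm : t ∈ cs.rightInvSeq η := by
    by_contra hm
    rw [List.count_eq_zero_of_not_mem hm] at hc
    simp at hc
  have h2 := (cs.isRightInversion_of_mem_rightInvSeq hη hm).2
  rw [← he, mul_assoc, ht.mul_self, mul_one] at h2
  omega

/-- Left multiplication by a simple reflection preserves the covering relation `y < y t`, unless
it exchanges `y` and `y t`. -/
theorem simple_mul_reflection {y t : W} {i : B} (ht : cs.IsReflection t)
    (h : cs.length y < cs.length (y * t)) :
    cs.simple i * y = y * t ∨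
      cs.length (cs.simple i * y) < cs.length (cs.simple i * y * t) := by
  by_contra! hc
  obtain ⟨hne, hle⟩ := hc
  have hinv : cs.IsRightInversion (cs.simple i * y) t :=
    ⟨ht, lt_of_le_of_ne hle (ht.length_mul_left_ne _)⟩
  by_cases hy : cs.length y < cs.length (cs.simple i * y)
  -- The inversions of `i :: η` are `y⁻¹ s_i y` and those of the reduced word `η` of `y`. The former
  -- gives the excluded equation `s_i y = y t`, the latter would make `y t` shorter than `y`.
  · obtain ⟨η, hη, rfl⟩ := cs.exists_isReduced y
    rw [← cs.wordProd_cons] at hinv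
    have hm := mem_rightInvSeq_of_isRightInversion cs hinv
    rw [rightInvSeq, List.mem_cons] at hm
    rcases hm with rfl | hm
    · apply hne
      group
    · have := (cs.isRightInversion_of_mem_rightInvSeq hη hm).2
      omega
  -- Here `i :: η` is a reduced word of `y`, and the inversions of `η` are among its inversions, so
  -- `t` would again shorten `y`.
  · obtain ⟨η, hη, he⟩ := cs.exists_isReduced (cs.simple i * y)
    have hy' : y = cs.wordProd (i :: η) := by
      rw [cs.wordProd_cons, ← he, cs.simple_mul_simple_cancel_left]
    have hred : cs.IsReduced (i :: η) := by
      rw [isReduced_cons_iff cs hη, ← he, cs.simple_mul_simple_cancel_left]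
      exact lt_of_le_of_ne (not_lt.mp hy) (cs.length_simple_mul_ne _ _)
    rw [he] at hinv
    have hm := mem_rightInvSeq_of_isRightInversion cs hinv
    have := (cs.isRightInversion_of_mem_rightInvSeq hred
      (List.mem_cons_of_mem _ hm : t ∈ cs.rightInvSeq (i :: η))).2
    rw [← hy'] at this
    omega

end Bruhat

/-! ### Lifting property and subwords in the Bruhat order of `W(X)` -/

section WeylBruhat

variable {X : CartanType}

theorem bruhatLE_simple_mul {w : Weyl X} {i : Node X}
    (h : (weylSystem X).length w < (weylSystem X).length ((weylSystem X).simple i * w)) :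
    BruhatLE X w ((weylSystem X).simple i * w) := by
  apply Relation.ReflTransGen.single
  -- `BruhatLE` multiplies on the right, so the left factor `s_i` becomes the conjugate reflection
  -- `w⁻¹ s_i w`.
  refine ⟨w⁻¹ * (weylSystem X).simple i * w, ?_, by group, h⟩
  simpa using ((weylSystem X).isReflection_simple i).conj w⁻¹

/-- A form of the lifting property. A chain from `w` to `v` is multiplied by `s_i` link by link;
where `s_i` exchanges the two ends of a link, the new chain rejoins the old one and follows it to
`v`. -/
theorem simple_mul_bruhatLE {w v : Weyl X} (h : BruhatLE X w v) (i : Node X) :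
    BruhatLE X ((weylSystem X).simple i * w) v ∨
      BruhatLE X ((weylSystem X).simple i * w) ((weylSystem X).simple i * v) := by
  induction h with
  | refl => exact Or.inr Relation.ReflTransGen.refl
  | tail _ hyz ih =>
    rcases ih with ih | ih
    · exact Or.inl (ih.tail hyz)
    · obtain ⟨t, ht, rfl, hl⟩ := hyz
      rcases simple_mul_reflection (weylSystem X) (i := i) ht hl with e | hlt
      · left
        rwa [← e]
      · right
        rw [← mul_assoc]
        exact ih.tail ⟨t, ht, rfl, hlt⟩

/-- The Demazure product of a subword of a reduced word is below the product of the word. -/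
theorem demazure_selected_bruhatLE (i : List (Node X)) (hi : (weylSystem X).IsReduced i) :
    ∀ c : Fin i.length → Fin 2,
      BruhatLE X (demazure (weylSystem X) (selected i c)) ((weylSystem X).wordProd i) := by
  induction i with
  | nil =>
    intro c
    rw [selected, demazure, CoxeterSystem.wordProd_nil]
    exact Relation.ReflTransGen.refl
  | cons s i ih =>
    intro c
    have hred := isReduced_tail _ hi
    have hup := bruhatLE_simple_mul ((isReduced_cons_iff _ hred).1 hi)
    have hle := ih hred (fun k => c k.succ)
    rw [selected, CoxeterSystem.wordProd_cons]
    split_ifs with h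
    · rw [demazure]
      split_ifs with h'
      -- Lifting places the lengthened Demazure product below the shorter word's product or below
      -- `s` times it; the former lies below the latter since the word is reduced.
      · rcases simple_mul_bruhatLE hle s with h1 | h1
        · exact h1.trans hup
        · exact h1
      · exact hle.trans hup
    · exact hle.trans hup

end WeylBruhat

end KGroth

theorem proposition11 (X : KGroth.CartanType) (w v : KGroth.Weyl X) :
    (∀ i : List (KGroth.Node X), (KGroth.weylSystem X).IsReduced i →
      (KGroth.weylSystem X).wordProd i = v →
        KGroth.localization X (KGroth.groth X w) v =
          KGroth.smashEps X (∑ c ∈ KGroth.subwords X i w,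
            KGroth.beta KGroth.Rb ^ (KGroth.weight c - (KGroth.weylSystem X).length w) •
              KGroth.smashProd X i c)) ∧
    (¬ KGroth.BruhatLE X w v → KGroth.localization X (KGroth.groth X w) v = 0) := by
  refine ⟨?_, fun h => ?_⟩
  · rintro i _ rfl
    exact KGroth.localization_groth_wordProd X w i
  · obtain ⟨i, hi, rfl⟩ := (KGroth.weylSystem X).exists_isReduced v
    -- A member would exhibit `w` as the Demazure product of a subword of a reduced word of `v`,
    -- hence `w ≤ v`.
    have hempty : KGroth.subwords X i w = ∅ := by
      rw [Finset.eq_empty_iff_forall_notMem]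
      intro c hc
      rw [KGroth.mem_subwords] at hc
      exact h (hc ▸ KGroth.demazure_selected_bruhatLE i hi c)
    rw [KGroth.localization_groth_wordProd, hempty, Finset.sum_empty, map_zero]
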